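/- All planar maps here are connected planar multigraphs (finite, loops and multiple edges allowed) properly embedded in the oriented sphere, rooted at one of their half-edges, and considered up to orientation-preserving homeomorphism (equivalently, up to isomorphism of rotation systems of genus $0$, preserving the root); the vertex map (one vertex and no edge, hence no root half-edge) is included. The size $|\mathfrak m|$ is the number of edges. A tree-rooted map is a map together with one of its spanning trees. A map is separable if its edge set can be partitioned into two non-empty subsets such that exactly one vertex is incident to both; otherwise it is $2$-connected (in particular the vertex map is $2$-connected). A block of $\mathfrak m$ is a maximal $2$-connected submap with at least one edge, and $b(\mathfrak m)$ is the number of blocks of $\mathfrak m$. Let $\mathcal M$ be the set of tree-rooted maps and $\mathcal B\subseteq\mathcal M$ the set of those whose underlying map is $2$-connected. Proposition. For every $n\ge 0$ there are finitely many tree-rooted maps of size $n$, and the formal power series $$M(z)=\sum_{\mathfrak m\in\mathcal M}z^{|\mathfrak m|}\in\mathbb Z[[z]],\qquad B(y)=\sum_{\mathfrak m\in\mathcal B}y^{|\mathfrak m|}\in\mathbb Z[[y]],\qquad M(z,u)=\sum_{\mathfrak m\in\mathcal M}z^{|\mathfrak m|}u^{b(\mathfrak m)}\in\mathbb Z[u][[z]]$$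 satisfy $$M(z)=B\bigl(zM(z)^2\bigr)\qquad\text{and}\qquad M(z,u)=u\,B\bigl(zM(z,u)^2\bigr)+1-u .$$ -/

import Mathlib

/-- A finite multigraph (loops and multiple edges allowed, no isolated vertex) drawn on an oriented
closed surface, given by its rotation system.  The elements of `Dart` are the half-edges; `σ` sends
a half-edge to the next one in counterclockwise order around its vertex, and `α` exchanges the two
half-edges of an edge. -/
structure CombMap where
  Dart : Type
  [finite : Finite Dart]
  σ : Equiv.Perm Dart
  α : Equiv.Perm Dart
  α_invol : ∀ d, α (α d) = d
  α_ne : ∀ d, α d ≠ d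

namespace CombMap

/-- Vertices are the cycles of `σ` (fixed points included). -/
def Vertex (m : CombMap) : Type := Quotient (Equiv.Perm.SameCycle.setoid m.σ)

/-- Edges are the cycles of `α`. -/
def Edge (m : CombMap) : Type := Quotient (Equiv.Perm.SameCycle.setoid m.α)

/-- Faces are the cycles of `σ ∘ α`. -/
def Face (m : CombMap) : Type := Quotient (Equiv.Perm.SameCycle.setoid (m.σ * m.α))

/-- The vertex to which a half-edge is incident. -/
def vert (m : CombMap) (d : m.Dart) : m.Vertex := Quotient.mk _ d

/-- The number of edges. -/
noncomputable def size (m : CombMap) : ℕ := Nat.card m.Edge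

/-- Sets of edges are represented by sets of half-edges that are stable under `α`. -/
def IsEdgeSet (m : CombMap) (S : Set m.Dart) : Prop := ∀ d ∈ S, m.α d ∈ S

/-- `u` and `v` are the two ends of an edge of `S`. -/
def Adj (m : CombMap) (S : Set m.Dart) (u v : m.Vertex) : Prop :=
  ∃ d ∈ S, m.vert d = u ∧ m.vert (m.α d) = v

/-- There is a (possibly empty) path from `u` to `v` that uses only edges of `S`. -/
def Joined (m : CombMap) (S : Set m.Dart) : m.Vertex → m.Vertex → Prop :=
  Relation.ReflTransGen (m.Adj S)

def IsConnected (m : CombMap) : Prop := ∀ u v : m.Vertex, m.Joined Set.univ u v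

/-- For a connected map: the surface is the sphere (Euler's formula). -/
def IsPlanar (m : CombMap) : Prop :=
  Nat.card m.Vertex + Nat.card m.Face = Nat.card m.Edge + 2

/-- The edge set `T` contains no cycle: no edge of `T` (in particular no loop) has its two ends
joined by a path in the other edges of `T`. -/
def IsAcyclic (m : CombMap) (T : Set m.Dart) : Prop :=
  ∀ d ∈ T, ¬ m.Joined (T \ {d, m.α d}) (m.vert d) (m.vert (m.α d))

/-- The edge set `T` is a spanning tree: it joins all the vertices of the map and has no cycle. -/
def IsSpanningTree (m : CombMap) (T : Set m.Dart) : Prop :=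
  m.IsEdgeSet T ∧ (∀ u v : m.Vertex, m.Joined T u v) ∧ m.IsAcyclic T

/-- The vertex `v` is incident to some edge of the edge set `S`. -/
def IncidentTo (m : CombMap) (S : Set m.Dart) (v : m.Vertex) : Prop := ∃ d ∈ S, m.vert d = v

/-- The submap with edge set `S` is separable: `S` is partitioned into two non-empty edge sets such
that exactly one vertex is incident to both. -/
def IsSeparable (m : CombMap) (S : Set m.Dart) : Prop :=
  ∃ A B : Set m.Dart, m.IsEdgeSet A ∧ m.IsEdgeSet B ∧ A.Nonempty ∧ B.Nonempty ∧
    Disjoint A B ∧ A ∪ B = S ∧ ∃! v, m.IncidentTo A v ∧ m.IncidentTo B v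

/-- `S` is the edge set of a submap of positive size (submaps are connected, and such a submap is
determined by its edges). -/
def IsSubmap (m : CombMap) (S : Set m.Dart) : Prop :=
  m.IsEdgeSet S ∧ S.Nonempty ∧
    ∀ u v : m.Vertex, m.IncidentTo S u → m.IncidentTo S v → m.Joined S u v

/-- A block is a maximal `2`-connected submap of positive size. -/
def IsBlock (m : CombMap) (S : Set m.Dart) : Prop :=
  Maximal (fun S' => m.IsSubmap S' ∧ ¬ m.IsSeparable S') S

noncomputable def numBlocks (m : CombMap) : ℕ := Nat.card {S : Set m.Dart // m.IsBlock S}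

def IsTwoConnected (m : CombMap) : Prop := ¬ m.IsSeparable Set.univ

/-- Isomorphisms preserve the orientation (they commute with `σ`, not with its inverse). -/
structure Iso (m m' : CombMap) where
  e : m.Dart ≃ m'.Dart
  map_σ : ∀ d, e (m.σ d) = m'.σ (e d)
  map_α : ∀ d, e (m.α d) = m'.α (e d)

end CombMap

/-- A tree-rooted planar map with at least one edge, with named half-edges: a connected planar map,
a root half-edge, and a spanning tree. -/
structure LabelledTreeRootedMap extends CombMap where
  connected : toCombMap.IsConnected
  planar : toCombMap.IsPlanar
  root : Dart
  tree : Set Dart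
  isSpanningTree : toCombMap.IsSpanningTree tree

namespace CombMap.Iso

def refl (m : CombMap) : Iso m m := ⟨Equiv.refl _, fun _ => rfl, fun _ => rfl⟩

def symm {m m' : CombMap} (f : Iso m m') : Iso m' m where
  e := f.e.symm
  map_σ d := by rw [Equiv.symm_apply_eq, f.map_σ, Equiv.apply_symm_apply]
  map_α d := by rw [Equiv.symm_apply_eq, f.map_α, Equiv.apply_symm_apply]

def trans {m m' m'' : CombMap} (f : Iso m m') (g : Iso m' m'') : Iso m m'' where
  e := f.e.trans g.e
  map_σ d := by simp [f.map_σ, g.map_σ]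
  map_α d := by simp [f.map_α, g.map_α]

theorem sameCycle_iff {X Y : Type} (e : X ≃ Y) (p : Equiv.Perm X) (q : Equiv.Perm Y)
    (h : ∀ x, e (p x) = q (e x)) (x y : X) : q.SameCycle (e x) (e y) ↔ p.SameCycle x y := by
  have hq : q = e.permCongrHom p := by
    ext y
    obtain ⟨x, rfl⟩ := e.surjective y
    simp [← h]
  have hz : ∀ i : ℤ, (q ^ i) (e x) = e ((p ^ i) x) := by
    intro i
    rw [hq, ← map_zpow]
    simp
  simp [Equiv.Perm.SameCycle, hz]

variable {m m' : CombMap}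

def vertexEquiv (f : Iso m m') : m.Vertex ≃ m'.Vertex :=
  Quotient.congr f.e fun x y => (sameCycle_iff f.e m.σ m'.σ f.map_σ x y).symm

theorem vertexEquiv_vert (f : Iso m m') (d : m.Dart) : f.vertexEquiv (m.vert d) = m'.vert (f.e d) := rfl

theorem size_eq (f : Iso m m') : m.size = m'.size :=
  Nat.card_congr (Quotient.congr f.e fun x y => (sameCycle_iff f.e m.α m'.α f.map_α x y).symm)

theorem symm_image_image (f : Iso m m') (S : Set m.Dart) : f.symm.e '' (f.e '' S) = S :=
  f.e.symm_image_image S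

theorem isEdgeSet (f : Iso m m') {S : Set m.Dart} (h : m.IsEdgeSet S) : m'.IsEdgeSet (f.e '' S) := by
  rintro _ ⟨d, hd, rfl⟩
  exact ⟨m.α d, h d hd, f.map_α d⟩

theorem joined (f : Iso m m') {S : Set m.Dart} {u v : m.Vertex} (h : m.Joined S u v) :
    m'.Joined (f.e '' S) (f.vertexEquiv u) (f.vertexEquiv v) := by
  refine Relation.ReflTransGen.lift f.vertexEquiv ?_ _ _ h
  rintro _ _ ⟨d, hd, rfl, rfl⟩
  exact ⟨f.e d, ⟨d, hd, rfl⟩, (f.vertexEquiv_vert d).symm, by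
    rw [vertexEquiv_vert, f.map_α]⟩

theorem incidentTo_iff (f : Iso m m') {S : Set m.Dart} {v : m.Vertex} :
    m'.IncidentTo (f.e '' S) (f.vertexEquiv v) ↔ m.IncidentTo S v := by
  constructor
  · rintro ⟨_, ⟨d, hd, rfl⟩, h⟩
    exact ⟨d, hd, f.vertexEquiv.injective (by rw [vertexEquiv_vert, h])⟩
  · rintro ⟨d, hd, rfl⟩
    exact ⟨f.e d, ⟨d, hd, rfl⟩, (f.vertexEquiv_vert d).symm⟩

theorem isSeparable (f : Iso m m') {S : Set m.Dart} (h : m.IsSeparable S) : m'.IsSeparable (f.e '' S) := by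
  obtain ⟨A, B, hA, hB, hA', hB', hd, hu, v, hv, hv'⟩ := h
  refine ⟨f.e '' A, f.e '' B, f.isEdgeSet hA, f.isEdgeSet hB, hA'.image _, hB'.image _,
    (Set.disjoint_image_iff f.e.injective).2 hd, by rw [← Set.image_union, hu],
    f.vertexEquiv v, ⟨f.incidentTo_iff.2 hv.1, f.incidentTo_iff.2 hv.2⟩, ?_⟩
  intro w hw
  obtain ⟨w, rfl⟩ := f.vertexEquiv.surjective w
  rw [hv' w ⟨f.incidentTo_iff.1 hw.1, f.incidentTo_iff.1 hw.2⟩]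

theorem isSubmap (f : Iso m m') {S : Set m.Dart} (h : m.IsSubmap S) : m'.IsSubmap (f.e '' S) := by
  refine ⟨f.isEdgeSet h.1, h.2.1.image _, fun u v hu hv => ?_⟩
  obtain ⟨u, rfl⟩ := f.vertexEquiv.surjective u
  obtain ⟨v, rfl⟩ := f.vertexEquiv.surjective v
  exact f.joined (h.2.2 u v (f.incidentTo_iff.1 hu) (f.incidentTo_iff.1 hv))

theorem isBlock (f : Iso m m') {S : Set m.Dart} (h : m.IsBlock S) : m'.IsBlock (f.e '' S) := by
  refine ⟨⟨f.isSubmap h.prop.1, fun hs => h.prop.2 ?_⟩, fun S' hS' hle => ?_⟩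
  · simpa only [symm_image_image] using f.symm.isSeparable hs
  · have h1 : m.IsSubmap (f.symm.e '' S') ∧ ¬ m.IsSeparable (f.symm.e '' S') :=
      ⟨f.symm.isSubmap hS'.1, fun hs => hS'.2 (by
        simpa only [show f.e '' (f.symm.e '' S') = S' from f.symm.symm_image_image S'] using
          f.isSeparable hs)⟩
    have h2 : S ≤ f.symm.e '' S' := by
      rw [← f.symm_image_image S]
      exact Set.image_mono hle
    have h3 := Set.image_mono (f := f.e) (h.le_of_ge h1 h2)
    rwa [show f.e '' (f.symm.e '' S') = S' from f.symm.symm_image_image S'] at h3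

theorem numBlocks_eq (f : Iso m m') : m.numBlocks = m'.numBlocks :=
  Nat.card_congr ((Equiv.Set.congr f.e).subtypeEquiv fun S =>
    ⟨fun h => f.isBlock h, fun h => by
      have := f.symm.isBlock h
      rwa [show f.symm.e '' (Equiv.Set.congr f.e S) = S from f.symm_image_image S] at this⟩)

theorem isTwoConnected_imp (f : Iso m m') (h : m.IsTwoConnected) : m'.IsTwoConnected := fun hs => h (by
  have := f.symm.isSeparable hs
  rwa [Set.image_univ_of_surjective f.symm.e.surjective] at this)

theorem isTwoConnected_eq (f : Iso m m') : m.IsTwoConnected = m'.IsTwoConnected :=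
  propext ⟨f.isTwoConnected_imp, f.symm.isTwoConnected_imp⟩

end CombMap.Iso

/-- Two tree-rooted maps are identified when an isomorphism of maps preserves root and tree. -/
def LabelledTreeRootedMap.Equivalent (m m' : LabelledTreeRootedMap) : Prop :=
  ∃ f : CombMap.Iso m.toCombMap m'.toCombMap, f.e m.root = m'.root ∧ f.e '' m.tree = m'.tree

instance LabelledTreeRootedMap.setoid : Setoid LabelledTreeRootedMap where
  r := LabelledTreeRootedMap.Equivalent
  iseqv :=
    { refl := fun m => ⟨CombMap.Iso.refl _, rfl, Set.image_id _⟩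
      symm := by
        intro m m' h
        obtain ⟨f, h1, h2⟩ := h
        refine ⟨f.symm, ?_, ?_⟩
        · rw [← h1]
          exact f.e.symm_apply_apply _
        · rw [← h2]
          exact f.symm_image_image _
      trans := by
        intro m m' m'' h h'
        obtain ⟨f, h1, h2⟩ := h
        obtain ⟨g, h3, h4⟩ := h'
        refine ⟨f.trans g, ?_, ?_⟩
        · rw [← h3, ← h1]
          rfl
        · rw [← h4, ← h2, Set.image_image]
          rfl }

/-- Tree-rooted planar maps: the vertex map (a single vertex, no edge, hence no root half-edge, with
its unique spanning tree), and the isomorphism classes of tree-rooted maps of positive size. -/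
inductive TreeRootedMap : Type 1
  | vertexMap : TreeRootedMap
  | ofClass : Quotient LabelledTreeRootedMap.setoid → TreeRootedMap

namespace TreeRootedMap

/-- The number of edges. -/
noncomputable def size : TreeRootedMap → ℕ
  | vertexMap => 0
  | ofClass c => Quotient.lift (fun m : LabelledTreeRootedMap => m.toCombMap.size)
      (fun a b (h : a.Equivalent b) => h.elim fun f _ => f.size_eq) c

noncomputable def numBlocks : TreeRootedMap → ℕ
  | vertexMap => 0
  | ofClass c => Quotient.lift (fun m : LabelledTreeRootedMap => m.toCombMap.numBlocks)
      (fun a b (h : a.Equivalent b) => h.elim fun f _ => f.numBlocks_eq) c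

/-- The vertex map is `2`-connected by convention. -/
def IsTwoConnected : TreeRootedMap → Prop
  | vertexMap => True
  | ofClass c => Quotient.lift (fun m : LabelledTreeRootedMap => m.toCombMap.IsTwoConnected)
      (fun a b (h : a.Equivalent b) => h.elim fun f _ => f.isTwoConnected_eq) c

/-- `M(z)`, the generating series of tree-rooted maps by number of edges. -/
noncomputable def seriesM : PowerSeries ℤ :=
  PowerSeries.mk fun n => (Nat.card {m : TreeRootedMap // m.size = n} : ℤ)

/-- `B(y)`, the generating series of `2`-connected tree-rooted maps by number of edges. -/
noncomputable def seriesB : PowerSeries ℤ :=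
  PowerSeries.mk fun n => (Nat.card {m : TreeRootedMap // m.IsTwoConnected ∧ m.size = n} : ℤ)

/-- `M(z,u)`, the sum of `z ^ size * u ^ numBlocks` over all tree-rooted maps, as a power series
in `z` whose coefficients are polynomials in `u`. -/
noncomputable def seriesMu : PowerSeries (Polynomial ℤ) :=
  PowerSeries.mk fun n => ∑ᶠ m : {m : TreeRootedMap // m.size = n},
    (Polynomial.X : Polynomial ℤ) ^ (m : TreeRootedMap).numBlocks

end TreeRootedMap

/-! The proof rests on Mullin's encoding. The walk around the spanning tree, started at the root,
meets the half-edges in an order `0, …, 2n - 1`. The edges become the arcs of a perfect matching,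
marked as tree or non-tree. Let `τ` exchange the ends of tree arcs only and `τ'` those of the other
arcs. Then the vertices are the cycles of `x ↦ τ x + 1` and the faces those of `x ↦ τ' x + 1`. The
number of cycles of `x ↦ f x + 1` is at most one more than the number of arcs of `f`, with equality
exactly when `f` is noncrossing (`card_cycles_rotPerm_eq_iff`). The marked arcs form a spanning tree
iff they do not cross, and Euler's formula then says that the other arcs do not cross either. Hence
tree-rooted maps of size `n` are the arc diagrams on `2n` points (`equivTreeRootedMap`), which also
gives finiteness.

Blocks correspond to the components of the crossing graph of the arcs (`isBlock_iff`). The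
fundamental cycle of a non-tree arc consists of that arc and the tree arcs crossing it, so a
component is connected and cannot be split at a vertex. Conversely, different components are
separated by an interval stable under the matching, and such an interval shares at most one vertex
with its complement. A nonseparable submap therefore stays inside one component.

Finally, cut the line just before each point of the component of `0` (`compPoly_fin`). The component
is a connected diagram, hence a `2`-connected map, and the gap after each of its points carries an
arbitrary diagram. A component with `d` edges has `2d` points, so with `z = t ^ 2` it contributes
`u` times `(t M) ^ (2d) = (z M ^ 2) ^ d`. The empty diagram has no component instead of one, whence
the correction `1 - u`. Setting `u = 1` gives the equation for `M(z)`. -/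

/-! ### Cycle counts of `x ↦ f x + 1` and noncrossing involutions -/

/-- The arcs joining `x` to `f x` are pairwise noncrossing. -/
def Noncrossing {L : Type*} [LinearOrder L] (f : L → L) : Prop :=
  ∀ x y, x < y → y < f x → ¬ f x < f y

theorem val_finRotate {N : ℕ} (x : Fin N) (h : (x : ℕ) + 1 < N) :
    (finRotate N x : ℕ) = x + 1 := by
  obtain ⟨n, rfl⟩ : ∃ n, N = n + 1 := ⟨N - 1, by omega⟩
  rw [coe_finRotate_of_ne_last]
  intro h'
  rw [h'] at h
  simp at h

theorem finRotate_pred {N : ℕ} [NeZero N] (m : Fin N) (h : m ≠ 0) :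
    ∃ x : Fin N, (x : ℕ) + 1 = m ∧ finRotate N x = m := by
  have hm : (m : ℕ) ≠ 0 := fun h' => h (Fin.ext h')
  refine ⟨⟨m - 1, by omega⟩, by simp; omega, ?_⟩
  apply Fin.ext
  rw [val_finRotate]
  all_goals simp; omega

theorem val_finRotate_of_lt {N : ℕ} {x y : Fin N} (h : x < y) : (finRotate N x : ℕ) = x + 1 :=
  val_finRotate x (by omega)

theorem Equiv.Perm.SameCycle.invariant {X : Type*} [Finite X] {s : Equiv.Perm X} {x y : X}
    (h : s.SameCycle x y) {P : X → Prop} (hx : P x) (hP : ∀ z, P z → P (s z)) : P y := by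
  obtain ⟨n, rfl⟩ := h.exists_nat_pow_eq
  clear h
  induction n with
  | zero => exact hx
  | succ n ih => rw [pow_succ']; exact hP _ ih

section

variable {N : ℕ} {f : Fin N → Fin N} (hf : f.Involutive)

/-- The permutation `x ↦ f x + 1`. -/
def rotPerm : Equiv.Perm (Fin N) := finRotate N * hf.toPerm

theorem rotPerm_apply (x : Fin N) : rotPerm hf x = finRotate N (f x) := rfl

/-- `m` is the least element of its cycle. -/
def IsCycleMin (s : Equiv.Perm (Fin N)) (m : Fin N) : Prop := ∀ y, s.SameCycle m y → m ≤ y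

theorem exists_isCycleMin (s : Equiv.Perm (Fin N)) (x : Fin N) :
    ∃ m, s.SameCycle x m ∧ IsCycleMin s m := by
  obtain ⟨m, hm⟩ := {y | s.SameCycle x y}.toFinite.exists_minimal ⟨x, .refl _ _⟩
  refine ⟨m, hm.prop, fun y hy => ?_⟩
  by_contra hlt
  exact hlt (hm.le_of_le (hm.prop.trans hy) (not_le.1 hlt).le)

/-- The predecessor of `m = x + 1` in its cycle is `f x`, so minimality gives `f x ≥ m > x`. -/
theorem IsCycleMin.opener [NeZero N] {m : Fin N} (h : IsCycleMin (rotPerm hf) m) (h0 : m ≠ 0) :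
    ∃ x, x < f x ∧ finRotate N x = m := by
  obtain ⟨x, hx, hxm⟩ := finRotate_pred m h0
  have : m ≤ f x := h _ (by
    have : rotPerm hf (f x) = m := by rw [rotPerm_apply, hf x, hxm]
    rw [← this]
    exact (Equiv.Perm.sameCycle_apply_left.2 (.refl _ _)))
  exact ⟨x, by omega, hxm⟩

include hf in
theorem Noncrossing.interval (h : Noncrossing f) {a x : Fin N} (h1 : a < x) (h2 : x < f a) :
    a < f x ∧ f x < f a := by
  have ne1 : f x ≠ a := fun h' => by rw [← h', hf x] at h2; exact h2.ne rfl
  have ne2 : f x ≠ f a := fun h' => h1.ne (hf.injective h').symm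
  constructor
  · by_contra hlt
    have := h (f x) a (by omega) (by rwa [hf x])
    rw [hf x] at this
    exact this h2
  · have := h a x h1 h2
    omega

/-- The half-open interval `(a, f a]` is a union of cycles: `f` preserves its interior and `f a` is
sent to `a + 1`. -/
theorem Noncrossing.rotPerm_mem (h : Noncrossing f) {a : Fin N} (ha : a < f a) (x : Fin N)
    (hx : a < x ∧ x ≤ f a) : a < rotPerm hf x ∧ rotPerm hf x ≤ f a := by
  rw [rotPerm_apply]
  rcases hx.2.eq_or_lt with rfl | hlt
  · rw [hf a]
    have := val_finRotate_of_lt ha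
    omega
  · obtain ⟨h1, h2⟩ := h.interval hf hx.1 hlt
    have := val_finRotate_of_lt h2
    omega

theorem Noncrossing.isCycleMin (h : Noncrossing f) {a : Fin N} (ha : a < f a) :
    IsCycleMin (rotPerm hf) (finRotate N a) := by
  intro y hy
  have h0 := val_finRotate_of_lt ha
  have := (hy.invariant (P := fun x => a < x ∧ x ≤ f a) (by omega) (h.rotPerm_mem hf ha)).1
  omega

theorem noncrossing_of_isCycleMin
    (h : ∀ a, a < f a → IsCycleMin (rotPerm hf) (finRotate N a)) : Noncrossing f := by
  have step (x : Fin N) : (rotPerm hf).SameCycle x (finRotate N (f x)) :=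
    Equiv.Perm.sameCycle_apply_right.2 (.refl _ _)
  have step' (x : Fin N) : (rotPerm hf).SameCycle (f x) (finRotate N x) := by
    simpa [hf x] using step (f x)
  have key : ∀ k : ℕ, ∀ a : Fin N, a < f a → (f a : ℕ) - a = k →
      ∀ p, a < p → p < f a → a < f p ∧ f p < f a := by
    intro k
    induction k using Nat.strong_induction_on with
    | _ k ih =>
    intro a ha hk
    have hra := val_finRotate_of_lt ha
    -- Descent of `q` from `f a` to `a + 1`, keeping `q` in the cycle of `a + 1` and `f` mapping
    -- `[q, f a)` into `(a, f a)`. With `p = q - 1`, the point `f p` precedes `q` in this cycle,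
    -- hence lies above `a`.
    have inner : ∀ j : ℕ, ∀ q : Fin N, a < q → q ≤ f a → (q : ℕ) - a = j →
        (rotPerm hf).SameCycle (finRotate N a) q →
        (∀ p, q ≤ p → p < f a → a < f p ∧ f p < f a) →
        ∀ p, a < p → p < f a → a < f p ∧ f p < f a := by
      intro j
      induction j using Nat.strong_induction_on with
      | _ j ihj =>
      intro q hq1 hq2 hj hcyc hst
      by_cases hqa : (q : ℕ) = a + 1
      · intro p hp1 hp2
        exact hst p (by omega) hp2
      obtain ⟨p, hp, hpq⟩ := @finRotate_pred N ⟨by omega⟩ q (by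
        intro h'
        have := congrArg Fin.val h'
        simp at this
        omega)
      have hpc : (rotPerm hf).SameCycle (finRotate N a) (f p) := hcyc.trans (by
        have := step' p
        rw [hpq] at this
        exact this.symm)
      have hle := h a ha _ hpc
      rcases lt_trichotomy (f p) p with hlt | heq | hgt
      -- The arc from `f p` to `p` is shorter than that of `a`, so the outer induction makes its
      -- interior stable and `q` may jump to `f p`.
      · refine ihj (f p - a) (by omega) (f p) (by omega) (by omega) rfl hpc ?_
        have hP := ih (f (f p) - f p) (by rw [hf p]; omega) (f p) (by rwa [hf p]) rfl
        rw [hf p] at hP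
        intro r hr1 hr2
        rcases hr1.eq_or_lt with rfl | hr1
        · rw [hf p]; omega
        rcases lt_trichotomy r p with hrp | rfl | hrp
        · have := hP r hr1 hrp
          omega
        · omega
        · exact hst r (by omega) hr2
      · refine ihj (p - a) (by omega) p (by omega) (by omega) rfl (heq ▸ hpc) ?_
        intro r hr1 hr2
        rcases hr1.eq_or_lt with rfl | hr1
        · omega
        · exact hst r (by omega) hr2
      -- If `p` opened an arc, `q = p + 1` would be the minimum of a cycle containing the smaller
      -- point `a + 1`.
      · have := h p hgt (finRotate N a) (by rw [hpq]; exact hcyc.symm)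
        rw [hpq] at this
        omega
    refine inner _ (f a) ha le_rfl rfl ?_ (fun p h1 h2 => absurd h1 (not_le.2 h2))
    exact (step' a).symm
  intro x y hxy hyx hlt
  have := key _ x (hxy.trans hyx) rfl y hxy hyx
  omega

/-- Every cycle minimum is `0` or `x + 1` for an opener `x`. These candidates are distinct and meet
every cycle, so equality of cardinals means that each one is a minimum, which characterises
noncrossing. -/
theorem card_cycles_rotPerm_eq_iff [NeZero N] :
    Nat.card (Quotient (Equiv.Perm.SameCycle.setoid (rotPerm hf))) =
      Nat.card {x // x < f x} + 1 ↔ Noncrossing f := by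
  classical
  let g : Option {x // x < f x} → Fin N := fun o => o.elim 0 fun x => finRotate N x
  let Q := Quotient (Equiv.Perm.SameCycle.setoid (rotPerm hf))
  let G : Option {x // x < f x} → Q := fun o => Quotient.mk _ (g o)
  have hmin (m : Fin N) (hm : IsCycleMin (rotPerm hf) m) : ∃ o, g o = m := by
    by_cases h0 : m = 0
    · exact ⟨none, h0.symm⟩
    · obtain ⟨x, hx, hxm⟩ := hm.opener hf h0
      exact ⟨some ⟨x, hx⟩, hxm⟩
  have hsurj : Function.Surjective G := by
    rintro ⟨x⟩
    obtain ⟨m, hxm, hm⟩ := exists_isCycleMin (rotPerm hf) x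
    obtain ⟨o, rfl⟩ := hmin m hm
    exact ⟨o, Quotient.sound hxm.symm⟩
  have hinj : Function.Injective g := by
    rintro (_ | x) (_ | y) h
    · rfl
    · have h1 : ((0 : Fin N) : ℕ) = finRotate N y := congrArg Fin.val h
      rw [val_finRotate_of_lt y.2, Fin.val_zero] at h1
      omega
    · have h1 : (finRotate N x : ℕ) = (0 : Fin N) := congrArg Fin.val h
      rw [val_finRotate_of_lt x.2, Fin.val_zero] at h1
      omega
    · exact congrArg some (Subtype.ext ((finRotate N).injective h))
  rw [← Finite.card_option]
  constructor
  · intro hc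
    have hG : Function.Injective G :=
      ((Nat.bijective_iff_surjective_and_card G).2 ⟨hsurj, hc.symm⟩).1
    refine noncrossing_of_isCycleMin hf fun a ha => ?_
    obtain ⟨m, hxm, hm⟩ := exists_isCycleMin (rotPerm hf) (finRotate N a)
    obtain ⟨o, rfl⟩ := hmin m hm
    have : some ⟨a, ha⟩ = o := hG (Quotient.sound hxm)
    subst this
    exact hm
  · intro hnc
    refine (Nat.card_congr (Equiv.ofBijective G ⟨fun o o' h => hinj ?_, hsurj⟩)).symm
    have hcm (o) : IsCycleMin (rotPerm hf) (g o) := by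
      rcases o with _ | x
      · exact fun y _ => Fin.zero_le _
      · exact hnc.isCycleMin hf x.2
    have hs : (rotPerm hf).SameCycle (g o) (g o') := Quotient.exact h
    exact le_antisymm (hcm o _ hs) (hcm o' _ hs.symm)

end

/-! ### Arc systems and the components of their crossing graph -/

/-- A perfect matching of a linear order by arcs, some of which are marked as tree arcs. -/
@[ext]
structure ArcSystem (L : Type) [LinearOrder L] where
  α : L → L
  invol : α.Involutive
  ne : ∀ x, α x ≠ x
  tree : Set L
  stable : ∀ x ∈ tree, α x ∈ tree

/-- An arc system in which arcs of the same kind do not cross. -/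
@[ext]
structure ArcDiagram (L : Type) [LinearOrder L] extends ArcSystem L where
  noncross : ∀ x y, (x ∈ tree ↔ y ∈ tree) → x < y → y < α x → ¬ α x < α y

namespace ArcSystem

variable {L : Type} [LinearOrder L] (A : ArcSystem L)

theorem mem_tree_iff {x : L} : A.α x ∈ A.tree ↔ x ∈ A.tree :=
  ⟨fun h => by simpa [A.invol x] using A.stable _ h, A.stable x⟩

open Classical in
/-- The involution given by the tree arcs alone. -/
noncomputable def τ (x : L) : L := if x ∈ A.tree then A.α x else x

open Classical in
/-- The involution given by the arcs outside the tree alone. -/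
noncomputable def τ' (x : L) : L := if x ∈ A.tree then x else A.α x

variable {A}

theorem τ_of_mem {x : L} (h : x ∈ A.tree) : A.τ x = A.α x := if_pos h
theorem τ_of_notMem {x : L} (h : x ∉ A.tree) : A.τ x = x := if_neg h
theorem τ'_of_mem {x : L} (h : x ∈ A.tree) : A.τ' x = x := if_pos h
theorem τ'_of_notMem {x : L} (h : x ∉ A.tree) : A.τ' x = A.α x := if_neg h

variable (A)

theorem τ_involutive : A.τ.Involutive := fun x => by
  by_cases h : x ∈ A.tree
  · rw [τ_of_mem h, τ_of_mem (A.stable x h), A.invol x]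
  · rw [τ_of_notMem h, τ_of_notMem h]

theorem τ_α (x : L) : A.τ (A.α x) = A.τ' x := by
  by_cases h : x ∈ A.tree
  · rw [τ_of_mem (A.stable x h), A.invol x, τ'_of_mem h]
  · rw [τ_of_notMem (A.mem_tree_iff.not.2 h), τ'_of_notMem h]

theorem τ'_involutive : A.τ'.Involutive := fun x => by
  by_cases h : x ∈ A.tree
  · rw [τ'_of_mem h, τ'_of_mem h]
  · rw [τ'_of_notMem h, τ'_of_notMem (A.mem_tree_iff.not.2 h), A.invol x]

theorem noncrossing_τ_iff : Noncrossing A.τ ↔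
    ∀ x y, x ∈ A.tree → y ∈ A.tree → x < y → y < A.α x → ¬ A.α x < A.α y := by
  constructor
  · intro h x y hx hy
    have := h x y
    rwa [τ_of_mem hx, τ_of_mem hy] at this
  · intro h x y hxy hyx hlt
    have hx : x ∈ A.tree := by
      by_contra hx
      exact (hxy.trans hyx).ne' (τ_of_notMem hx)
    have hy : y ∈ A.tree := by
      by_contra hy
      exact (hyx.trans hlt).ne' (τ_of_notMem hy)
    rw [τ_of_mem hx] at hyx hlt
    rw [τ_of_mem hy] at hlt
    exact h x y hx hy hxy hyx hlt

theorem noncrossing_τ'_iff : Noncrossing A.τ' ↔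
    ∀ x y, x ∉ A.tree → y ∉ A.tree → x < y → y < A.α x → ¬ A.α x < A.α y := by
  constructor
  · intro h x y hx hy
    have := h x y
    rwa [τ'_of_notMem hx, τ'_of_notMem hy] at this
  · intro h x y hxy hyx hlt
    have hx : x ∉ A.tree := fun hx => (hxy.trans hyx).ne' (τ'_of_mem hx)
    have hy : y ∉ A.tree := fun hy => (hyx.trans hlt).ne' (τ'_of_mem hy)
    rw [τ'_of_notMem hx] at hyx hlt
    rw [τ'_of_notMem hy] at hlt
    exact h x y hx hy hxy hyx hlt

theorem card_openers [Finite L] : Nat.card {x // x < A.α x} =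
    Nat.card {x // x < A.τ x} + Nat.card {x // x < A.τ' x} := by
  have h1 : {x | x < A.α x} = {x | x < A.τ x} ∪ {x | x < A.τ' x} := by
    ext x
    by_cases h : x ∈ A.tree <;> simp [h, τ_of_mem, τ_of_notMem, τ'_of_mem, τ'_of_notMem]
  have h2 : Disjoint {x | x < A.τ x} {x | x < A.τ' x} := by
    rw [Set.disjoint_left]
    intro x
    by_cases h : x ∈ A.tree <;> simp [h, τ_of_mem, τ_of_notMem, τ'_of_mem, τ'_of_notMem]
  have := Set.ncard_union_eq h2
  rwa [← h1] at this

theorem card_eq_two_mul [Finite L] : Nat.card L = 2 * Nat.card {x // x < A.α x} := by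
  have h1 : Nat.card {x // x < A.α x} = Nat.card {x // ¬ x < A.α x} := by
    refine Nat.card_congr (Equiv.subtypeEquiv A.invol.toPerm fun x => ?_)
    simp only [Function.Involutive.coe_toPerm, A.invol x, not_lt]
    exact ⟨le_of_lt, fun h => lt_of_le_of_ne h (A.ne x).symm⟩
  classical
  have := Nat.card_congr (Equiv.sumCompl fun x => x < A.α x)
  rw [Nat.card_sum] at this
  omega

/-- The arcs at `x` and `y` cross, and `x` is the leftmost of the four ends. -/
def Crosses (x y : L) : Prop := x < y ∧ y < A.α x ∧ A.α x < A.α y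

/-- The equivalence relation whose classes are the components of the crossing graph. -/
def comp : Setoid L := Relation.EqvGen.setoid fun x y => y = A.α x ∨ A.Crosses x y

variable {A}

theorem comp_α (x : L) : A.comp x (A.α x) := .rel _ _ (.inl rfl)

theorem Crosses.comp {x y : L} (h : A.Crosses x y) : A.comp x y := .rel _ _ (.inr h)

theorem comp_iff_of {P : L → Prop} (h1 : ∀ x, P x → P (A.α x))
    (h2 : ∀ x y, A.Crosses x y → (P x ↔ P y)) {x y : L} (h : A.comp x y) : P x ↔ P y := by
  induction h with
  | rel x y h =>
    rcases h with rfl | h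
    · exact ⟨h1 x, fun h => by simpa [A.invol x] using h1 _ h⟩
    · exact h2 x y h
  | refl x => rfl
  | symm x y _ ih => exact ih.symm
  | trans x y z _ _ ih1 ih2 => exact ih1.trans ih2

theorem interval_of_not_comp {a x : L} (hax : ¬ A.comp a x) (h : a < x ∧ x < A.α a) :
    a < A.α x ∧ A.α x < A.α a := by
  have h1 : A.α x ≠ a := by
    rintro rfl
    exact hax ((A.comp.symm (comp_α x)))
  have h2 : A.α x ≠ A.α a := fun h' => h.1.ne (A.invol.injective h').symm
  constructor
  · by_contra hlt
    have : A.Crosses (A.α x) a := by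
      refine ⟨lt_of_le_of_ne (not_lt.1 hlt) h1, ?_⟩
      rw [A.invol x]
      exact h
    exact hax (A.comp.symm (A.comp.trans (comp_α x) this.comp))
  · by_contra hlt
    exact hax (Crosses.comp ⟨h.1, h.2, lt_of_le_of_ne (not_lt.1 hlt) h2.symm⟩)

/-- An arc crosses no arc of another component, so that component lies wholly under it or wholly
outside. -/
theorem comp_mem_interval_iff {a x y : L} (h : A.comp x y) (hax : ¬ A.comp a x) :
    (a < x ∧ x < A.α a) ↔ (a < y ∧ y < A.α a) := by
  have key := comp_iff_of (P := fun z => A.comp x z → (a < x ∧ x < A.α a ↔ a < z ∧ z < A.α a))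
    ?_ ?_ h
  · exact key.1 (fun _ => Iff.rfl) h
  · intro z hz hxz
    have hxz' : A.comp x z := A.comp.trans hxz (A.comp.symm (comp_α z))
    have haz : ¬ A.comp a z := fun h => hax (A.comp.trans h (A.comp.symm hxz'))
    have haz' : ¬ A.comp a (A.α z) := fun h => hax (A.comp.trans h (A.comp.symm hxz))
    rw [hz hxz']
    refine ⟨interval_of_not_comp haz, fun h => ?_⟩
    simpa [A.invol z] using interval_of_not_comp haz' h
  · intro z w hzw
    have hs : A.comp x z ↔ A.comp x w :=
      ⟨fun h => A.comp.trans h hzw.comp, fun h => A.comp.trans h (A.comp.symm hzw.comp)⟩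
    rw [hs]
    refine forall_congr' fun hxw => ?_
    have haw : ¬ A.comp a w := fun h => hax (A.comp.trans h (A.comp.symm hxw))
    have haz : ¬ A.comp a z := fun h => haw (A.comp.trans h hzw.comp)
    have : (a < z ∧ z < A.α a) ↔ (a < w ∧ w < A.α a) := by
      obtain ⟨h1, h2, h3⟩ := hzw
      constructor
      · intro h
        have := interval_of_not_comp haz h
        exact ⟨h.1.trans h1, h2.trans this.2⟩
      · intro h
        have h' := interval_of_not_comp haw h
        have haz' : ¬ A.comp a (A.α z) := fun h => haz (A.comp.trans h (A.comp.symm (comp_α z)))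
        have := interval_of_not_comp haz' ⟨h.1.trans h2, h3.trans h'.2⟩
        rwa [A.invol z] at this
    rw [this]

/-- The smallest interval containing the component of `c`. -/
def hull (A : ArcSystem L) (c : L) : Set L := {y | ∃ x x', A.comp c x ∧ A.comp c x' ∧ x ≤ y ∧ y ≤ x'}

theorem mem_hull {c y : L} (h : A.comp c y) : y ∈ A.hull c := ⟨y, y, h, h, le_rfl, le_rfl⟩

theorem hull_ordConnected (c : L) : (A.hull c).OrdConnected := by
  refine ⟨?_⟩
  rintro y ⟨x, -, hx, -, hxy, -⟩ z ⟨-, x', -, hx', -, hzx⟩ w hw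
  exact ⟨x, x', hx, hx', hxy.trans hw.1, hw.2.trans hzx⟩

/-- An arc of another component with just one end in the hull would have on different sides two
points `x < y < x'` of the component of `c`. -/
theorem hull_stable (c : L) : ∀ y ∈ A.hull c, A.α y ∈ A.hull c := by
  rintro y ⟨x, x', hx, hx', hxy, hyx⟩
  by_cases hy : A.comp c y
  · exact mem_hull (A.comp.trans hy (comp_α y))
  have hxx : A.comp x x' := A.comp.trans (A.comp.symm hx) hx'
  have hyx' : ¬ A.comp y x := fun h => hy (A.comp.trans hx (A.comp.symm h))
  have hlt1 : x < y := lt_of_le_of_ne hxy (by rintro rfl; exact hy hx)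
  have hlt2 : y < x' := lt_of_le_of_ne hyx (by rintro rfl; exact hy hx')
  rcases lt_or_gt_of_ne (A.ne y) with h | h
  · have hyx'' : ¬ A.comp (A.α y) x := fun h => hyx' (A.comp.trans (comp_α y) h)
    have := comp_mem_interval_iff hxx hyx''
    rw [A.invol y] at this
    refine ⟨x, x', hx, hx', ?_, (h.trans hlt2).le⟩
    by_contra hc
    exact hlt2.not_gt (this.1 ⟨not_le.1 hc, hlt1⟩).2
  · have := comp_mem_interval_iff hxx hyx'
    refine ⟨x, x', hx, hx', (hlt1.trans h).le, ?_⟩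
    by_contra hc
    exact hlt1.not_gt (this.2 ⟨hlt2, not_le.1 hc⟩).1

theorem comp_mem_iff_of_ordConnected {G : Set L} (hG : G.OrdConnected)
    (hs : ∀ y ∈ G, A.α y ∈ G) {x y : L} (h : A.comp x y) : x ∈ G ↔ y ∈ G := by
  refine comp_iff_of hs (fun x y hxy => ⟨fun h => ?_, fun h => ?_⟩) h
  · exact hG.out h (hs x h) ⟨hxy.1.le, hxy.2.1.le⟩
  · simpa [A.invol x] using hs _ (hG.out h (hs y h) ⟨hxy.2.1.le, hxy.2.2.le⟩)

/-- One of the two hulls separates: if each contained the point of the other, both would have the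
same minimum, which belongs to both components. -/
theorem exists_separating [Finite L] {x y : L} (h : ¬ A.comp x y) :
    ∃ G : Set L, G.OrdConnected ∧ (∀ z ∈ G, A.α z ∈ G) ∧
      (x ∈ G ∧ y ∉ G ∨ x ∉ G ∧ y ∈ G) := by
  by_cases hy : y ∈ A.hull x
  swap
  · exact ⟨_, hull_ordConnected x, hull_stable x, .inl ⟨mem_hull (A.comp.refl x), hy⟩⟩
  by_cases hx : x ∈ A.hull y
  swap
  · exact ⟨_, hull_ordConnected y, hull_stable y, .inr ⟨hx, mem_hull (A.comp.refl y)⟩⟩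
  have hmin (c : L) : ∃ m, A.comp c m ∧ ∀ z, A.comp c z → m ≤ z := by
    obtain ⟨m, hm⟩ := {z | A.comp c z}.toFinite.exists_minimal ⟨c, A.comp.refl c⟩
    refine ⟨m, hm.prop, fun z hz => ?_⟩
    by_contra hlt
    exact hlt (hm.le_of_le hz (not_le.1 hlt).le)
  obtain ⟨m, hxm, hm⟩ := hmin x
  obtain ⟨m', hym, hm'⟩ := hmin y
  obtain ⟨z, -, hz, -, hzm, -⟩ :=
    (comp_mem_iff_of_ordConnected (hull_ordConnected y) (hull_stable y) hxm).1 hx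
  obtain ⟨w, -, hw, -, hwm, -⟩ :=
    (comp_mem_iff_of_ordConnected (hull_ordConnected x) (hull_stable x) hym).1 hy
  have : m = m' := le_antisymm ((hm w hw).trans hwm) ((hm' z hz).trans hzm)
  subst this
  exact absurd (A.comp.trans hxm (A.comp.symm hym)) h

end ArcSystem

/-! ### Walks in an edge set -/

namespace CombMap

variable (m : CombMap)

instance : Finite m.Dart := m.finite

theorem vert_eq_iff {x y : m.Dart} : m.vert x = m.vert y ↔ m.σ.SameCycle x y :=
  ⟨fun h => Quotient.exact h, fun h => Quotient.sound h⟩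

theorem vert_σ (x : m.Dart) : m.vert (m.σ x) = m.vert x :=
  m.vert_eq_iff.2 (Equiv.Perm.sameCycle_apply_left.2 (.refl _ _))

theorem vert_surjective : Function.Surjective m.vert := Quotient.mk_surjective

variable {m}

theorem Joined.mono {S S' : Set m.Dart} (h : S ⊆ S') {u v : m.Vertex} (huv : m.Joined S u v) :
    m.Joined S' u v :=
  Relation.ReflTransGen.mono (fun _ _ ⟨d, hd, h1⟩ => ⟨d, h hd, h1⟩) _ _ huv

theorem joined_α {S : Set m.Dart} {d : m.Dart} (h : d ∈ S) :
    m.Joined S (m.vert d) (m.vert (m.α d)) := .single ⟨d, h, rfl, rfl⟩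

theorem Joined.symm {S : Set m.Dart} (hS : m.IsEdgeSet S) {u v : m.Vertex}
    (h : m.Joined S u v) : m.Joined S v u := by
  have : Std.Symm (m.Adj S) := ⟨by
    rintro _ _ ⟨d, hd, rfl, rfl⟩
    exact ⟨m.α d, hS d hd, rfl, by rw [m.α_invol]⟩⟩
  exact Relation.ReflTransGen.stdSymm.symm _ _ h

theorem Joined.iff_of {S : Set m.Dart} {P : m.Vertex → Prop}
    (hP : ∀ d ∈ S, (P (m.vert d) ↔ P (m.vert (m.α d)))) {u v : m.Vertex} (h : m.Joined S u v) :
    P u ↔ P v := by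
  induction h with
  | refl => rfl
  | tail _ h ih =>
    obtain ⟨d, hd, rfl, rfl⟩ := h
    exact ih.trans (hP d hd)

theorem IsEdgeSet.mem_iff {S : Set m.Dart} (h : m.IsEdgeSet S) {d : m.Dart} :
    m.α d ∈ S ↔ d ∈ S := ⟨fun hd => by simpa [m.α_invol] using h _ hd, h d⟩

theorem IsEdgeSet.diff_pair {S : Set m.Dart} (h : m.IsEdgeSet S) (d : m.Dart) :
    m.IsEdgeSet (S \ {d, m.α d}) := by
  rintro x ⟨hx, hxd⟩
  simp only [Set.mem_insert_iff, Set.mem_singleton_iff, not_or] at hxd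
  refine ⟨h x hx, ?_⟩
  simp only [Set.mem_insert_iff, Set.mem_singleton_iff, not_or]
  exact ⟨fun h' => hxd.2 (by rw [← h', m.α_invol]), fun h' => hxd.1 (m.α.injective h')⟩

end CombMap

/-! ### From arc diagrams to tree-rooted maps -/

namespace ArcSystem

variable {N : ℕ} (A : ArcSystem (Fin N))

/-- The map whose half-edges are met in the order `0, 1, …, N - 1` by the contour of the tree. -/
noncomputable def toCombMap : CombMap where
  Dart := Fin N
  σ := rotPerm A.τ_involutive
  α := A.invol.toPerm
  α_invol := A.invol
  α_ne := A.ne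

theorem toCombMap_σ (x : Fin N) : A.toCombMap.σ x = finRotate N (A.τ x) := rfl

/-- The vertex of `A.toCombMap` incident to `x`. -/
noncomputable def vert (x : Fin N) : A.toCombMap.Vertex := A.toCombMap.vert x

theorem vert_finRotate (x : Fin N) : A.vert (finRotate N x) = A.vert (A.τ x) := by
  have := A.toCombMap.vert_σ (A.τ x)
  rwa [toCombMap_σ, A.τ_involutive x] at this

theorem vert_eq_iff {x y : Fin N} : A.vert x = A.vert y ↔ (rotPerm A.τ_involutive).SameCycle x y :=
  A.toCombMap.vert_eq_iff

theorem card_vertex_eq_iff [NeZero N] :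
    Nat.card A.toCombMap.Vertex = Nat.card {x // x < A.τ x} + 1 ↔ Noncrossing A.τ :=
  card_cycles_rotPerm_eq_iff A.τ_involutive

theorem card_face_eq_iff [NeZero N] :
    Nat.card A.toCombMap.Face = Nat.card {x // x < A.τ' x} + 1 ↔ Noncrossing A.τ' := by
  rw [← card_cycles_rotPerm_eq_iff A.τ'_involutive]
  have : A.toCombMap.σ * A.toCombMap.α = rotPerm A.τ'_involutive := by
    refine Equiv.ext fun x : Fin N => ?_
    exact congrArg (finRotate N) (A.τ_α x)
  unfold CombMap.Face
  rw [this]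
  rfl

theorem card_edge : Nat.card A.toCombMap.Edge = Nat.card {x // x < A.α x} := by
  have key (x y : Fin N) : A.toCombMap.α.SameCycle x y ↔ y = x ∨ y = A.α x := by
    constructor
    · intro h
      exact h.invariant (P := fun y => y = x ∨ y = A.α x) (.inl rfl) (by
        rintro z (rfl | rfl)
        · exact .inr rfl
        · exact .inl (A.invol x))
    · rintro (rfl | rfl)
      · exact .refl _ _
      · exact Equiv.Perm.sameCycle_apply_right.2 (.refl _ _)
  refine (Nat.card_congr (Equiv.ofBijective
    (fun x : {x // x < A.α x} => (Quotient.mk _ x.1 : A.toCombMap.Edge)) ⟨?_, ?_⟩)).symm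
  · intro x y h
    have h1 : A.toCombMap.α.SameCycle x.1 y.1 := Quotient.exact h
    rcases (key _ _).1 h1 with h | h
    · exact Subtype.ext h.symm
    · have := y.2
      rw [h, A.invol] at this
      exact absurd x.2 this.not_gt
  · rintro ⟨x : Fin N⟩
    rcases lt_or_gt_of_ne (A.ne x) with h | h
    · exact ⟨⟨A.α x, by rwa [A.invol]⟩, Quotient.sound ((key _ _).2 (.inr (A.invol x).symm))⟩
    · exact ⟨⟨x, h⟩, rfl⟩

theorem two_mul_size : 2 * A.toCombMap.size = N := by
  have := A.card_eq_two_mul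
  rw [Nat.card_fin] at this
  rw [CombMap.size, card_edge, ← this]

/-- A contour step from `p` to `p + 1` either follows the tree edge at `p` or stays at the same
vertex. -/
theorem joined_vert [NeZero N] (x : Fin N) :
    A.toCombMap.Joined A.tree (A.vert 0) (A.vert x) := by
  obtain ⟨k, hk⟩ : ∃ k : ℕ, (x : ℕ) = k := ⟨_, rfl⟩
  induction k generalizing x with
  | zero => rw [show x = 0 from Fin.ext (by simpa using hk)]; exact .refl
  | succ k ih =>
    obtain ⟨p, hp, rfl⟩ := finRotate_pred x (fun h => by simp [h] at hk)
    rw [vert_finRotate]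
    refine (ih p (by omega)).trans ?_
    by_cases h : p ∈ A.tree
    · rw [τ_of_mem h]
      exact CombMap.joined_α (m := A.toCombMap) (d := p) h
    · rw [τ_of_notMem h]

theorem isEdgeSet_tree : A.toCombMap.IsEdgeSet A.tree := A.stable

theorem tree_joined [NeZero N] (u v : A.toCombMap.Vertex) : A.toCombMap.Joined A.tree u v := by
  obtain ⟨x, rfl⟩ := A.toCombMap.vert_surjective u
  obtain ⟨y, rfl⟩ := A.toCombMap.vert_surjective v
  exact ((A.joined_vert x).symm A.isEdgeSet_tree).trans (A.joined_vert y)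

/-- Removing a tree arc separates the vertices below it from the others. -/
theorem joined_diff_mem_iff (hnc : Noncrossing A.τ) {a : Fin N} (haT : a ∈ A.tree)
    (ha : a < A.α a) {x y : Fin N}
    (h : A.toCombMap.Joined (A.tree \ {a, A.α a}) (A.vert x) (A.vert y)) :
    (a < x ∧ x ≤ A.α a) ↔ (a < y ∧ y ≤ A.α a) := by
  have ha' : a < A.τ a := by rwa [τ_of_mem haT]
  have hinv {x y : Fin N} (h : A.vert x = A.vert y) (hx : a < x ∧ x ≤ A.α a) :
      a < y ∧ y ≤ A.α a := by
    rw [← τ_of_mem haT] at hx ⊢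
    exact (A.vert_eq_iff.1 h).invariant (P := fun x => a < x ∧ x ≤ A.τ a) hx
      (hnc.rotPerm_mem A.τ_involutive ha')
  -- The interval is a union of `σ`-cycles, so lying in it is a property of the vertex.
  have hP (x : Fin N) : (∃ z, A.vert z = A.vert x ∧ a < z ∧ z ≤ A.α a) ↔ a < x ∧ x ≤ A.α a :=
    ⟨fun ⟨z, hz, h⟩ => hinv hz h, fun h => ⟨x, rfl, h⟩⟩
  have hstep (d : Fin N) (hd : d ∈ A.tree) (hda : d ≠ A.α a) (h : a < d ∧ d ≤ A.α a) :
      a < A.α d ∧ A.α d ≤ A.α a := by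
    have := hnc.interval A.τ_involutive h.1 (by
      rw [τ_of_mem haT]; exact lt_of_le_of_ne h.2 hda)
    rw [τ_of_mem haT, τ_of_mem hd] at this
    exact ⟨this.1, this.2.le⟩
  have := CombMap.Joined.iff_of (P := fun v => ∃ z, A.vert z = v ∧ a < z ∧ z ≤ A.α a) ?_ h
  · rwa [hP, hP] at this
  · rintro (d : Fin N) ⟨hd, hda⟩
    have hda : d ∉ ({a, A.α a} : Set (Fin N)) := hda
    simp only [Set.mem_insert_iff, Set.mem_singleton_iff, not_or] at hda
    change (∃ z, A.vert z = A.vert d ∧ _) ↔ (∃ z, A.vert z = A.vert (A.α d) ∧ _)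
    rw [hP, hP]
    refine ⟨hstep d hd hda.2, fun h => ?_⟩
    have := hstep (A.α d) (A.stable d hd) (fun h => hda.1 (A.invol.injective h)) h
    rwa [A.invol d] at this

theorem isSpanningTree [NeZero N] (hnc : Noncrossing A.τ) :
    A.toCombMap.IsSpanningTree A.tree := by
  refine ⟨A.isEdgeSet_tree, A.tree_joined, fun (d : Fin N) hd h => ?_⟩
  have hset : ({d, A.α d} : Set (Fin N)) = {A.α d, d} := Set.pair_comm _ _
  have h : A.toCombMap.Joined (A.tree \ ({d, A.α d} : Set (Fin N))) (A.vert d)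
    (A.vert (A.α d)) := h
  rcases lt_or_gt_of_ne (A.ne d) with hlt | hlt
  · rw [hset] at h
    have := A.joined_diff_mem_iff hnc (a := A.α d) (A.stable d hd) (by rwa [A.invol])
      (x := d) (y := A.α d)
    rw [A.invol] at this
    exact ((this h).1 ⟨hlt, le_rfl⟩).1.false
  · exact ((A.joined_diff_mem_iff hnc hd hlt h).2 ⟨hlt, le_rfl⟩).1.false

/-- There is one more vertex than tree arcs, so Euler's formula asks for one more face than non-tree
arcs. -/
theorem isPlanar_iff [NeZero N] (hnc : Noncrossing A.τ) :
    A.toCombMap.IsPlanar ↔ Noncrossing A.τ' := by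
  rw [CombMap.IsPlanar, ← card_face_eq_iff, card_edge, card_openers, A.card_vertex_eq_iff.2 hnc]
  omega

end ArcSystem

namespace ArcDiagram

variable {L : Type} [LinearOrder L] (D : ArcDiagram L)

theorem noncrossing_τ : Noncrossing D.τ :=
  D.noncrossing_τ_iff.2 fun x y hx hy => D.noncross x y (by tauto)

theorem noncrossing_τ' : Noncrossing D.τ' :=
  D.noncrossing_τ'_iff.2 fun x y hx hy => D.noncross x y (by tauto)

/-- The tree-rooted map with contour `D`, rooted at the half-edge `0`. -/
noncomputable def toMap {N : ℕ} [NeZero N] (D : ArcDiagram (Fin N)) : LabelledTreeRootedMap where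
  toCombMap := D.toArcSystem.toCombMap
  connected u v := (D.toArcSystem.tree_joined u v).mono (Set.subset_univ _)
  planar := (D.toArcSystem.isPlanar_iff D.noncrossing_τ).2 D.noncrossing_τ'
  root := (0 : Fin N)
  tree := D.tree
  isSpanningTree := D.toArcSystem.isSpanningTree D.noncrossing_τ

end ArcDiagram

/-! ### From tree-rooted maps to arc diagrams: the contour of the tree -/

namespace CombMap

variable {m m' : CombMap}

theorem Iso.isSpanningTree (f : Iso m m') {T : Set m.Dart} (h : m.IsSpanningTree T) :
    m'.IsSpanningTree (f.e '' T) := by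
  refine ⟨f.isEdgeSet h.1, fun u v => ?_, ?_⟩
  · obtain ⟨u, rfl⟩ := f.vertexEquiv.surjective u
    obtain ⟨v, rfl⟩ := f.vertexEquiv.surjective v
    exact f.joined (h.2.1 u v)
  · rintro _ ⟨d, hd, rfl⟩ hj
    refine h.2.2 d hd ?_
    have h1 := f.symm.joined hj
    rw [vertexEquiv_vert, vertexEquiv_vert, f.symm.map_α,
      Set.image_sdiff f.symm.e.injective, Set.image_pair, f.symm.map_α, f.symm_image_image] at h1
    rwa [show f.symm.e (f.e d) = d from f.e.symm_apply_apply d] at h1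

theorem Iso.isPlanar (f : Iso m m') (h : m.IsPlanar) : m'.IsPlanar := by
  have h1 : Nat.card m.Vertex = Nat.card m'.Vertex := Nat.card_congr f.vertexEquiv
  have h2 : Nat.card m.Edge = Nat.card m'.Edge := f.size_eq
  have h3 : Nat.card m.Face = Nat.card m'.Face :=
    Nat.card_congr (Quotient.congr f.e fun x y => (sameCycle_iff f.e (m.σ * m.α) (m'.σ * m'.α)
      (fun x => by simp [f.map_σ, f.map_α]) x y).symm)
  rw [IsPlanar] at *
  omega

theorem joined_diff_α {T : Set m.Dart} {d x : m.Dart} {u : m.Vertex} (hx : x ∈ T)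
    (hxd : x ≠ d) (hxd' : x ≠ m.α d) (h : m.Joined (T \ {d, m.α d}) u (m.vert x)) :
    m.Joined (T \ {d, m.α d}) u (m.vert (m.α x)) :=
  h.trans (joined_α ⟨hx, by simp [hxd, hxd']⟩)

/-- The involution exchanging the half-edges of the edges of `T`. -/
noncomputable def swapOn (m : CombMap) (T : Set m.Dart) (x : m.Dart) : m.Dart :=
  open Classical in if x ∈ T then m.α x else x

theorem swapOn_of_mem {T : Set m.Dart} {x : m.Dart} (h : x ∈ T) : m.swapOn T x = m.α x := if_pos h

theorem swapOn_of_notMem {T : Set m.Dart} {x : m.Dart} (h : x ∉ T) : m.swapOn T x = x := if_neg h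

theorem swapOn_involutive {T : Set m.Dart} (hT : m.IsEdgeSet T) : (m.swapOn T).Involutive :=
  fun x => by
    by_cases h : x ∈ T
    · rw [swapOn_of_mem h, swapOn_of_mem (hT x h), m.α_invol]
    · rw [swapOn_of_notMem h, swapOn_of_notMem h]

/-- The walk around the submap with edge set `T`. -/
noncomputable def contour {T : Set m.Dart} (hT : m.IsEdgeSet T) : Equiv.Perm m.Dart :=
  m.σ * (swapOn_involutive hT).toPerm

theorem contour_apply {T : Set m.Dart} (hT : m.IsEdgeSet T) (x : m.Dart) :
    contour hT x = m.σ (m.swapOn T x) := rfl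

theorem vert_contour {T : Set m.Dart} (hT : m.IsEdgeSet T) (x : m.Dart) :
    m.vert (contour hT x) = m.vert (m.swapOn T x) := m.vert_σ _

/-- A contour leaving along `d` and returning to `d` without meeting `α d` would join the ends of
`d` without using this edge, closing a cycle in `T`. -/
theorem contour_sameCycle_α {T : Set m.Dart} (hT : m.IsEdgeSet T) (hac : m.IsAcyclic T)
    {d : m.Dart} (hd : d ∈ T) : (contour hT).SameCycle d (m.α d) := by
  by_contra hc
  have key (n : ℕ) :
      m.Joined (T \ {d, m.α d}) (m.vert (m.α d)) (m.vert ((contour hT ^ (n + 1)) d)) := by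
    induction n with
    | zero =>
      rw [zero_add, pow_one, vert_contour, swapOn_of_mem hd]
      exact .refl
    | succ n ih =>
      rw [pow_succ', Equiv.Perm.mul_apply, vert_contour]
      by_cases hx : (contour hT ^ (n + 1)) d ∈ T
      · rw [swapOn_of_mem hx]
        refine joined_diff_α hx (fun h => ?_) (fun h => hc ⟨(n + 1 : ℕ), by rwa [zpow_natCast]⟩) ih
        rw [h] at ih
        exact hac d hd (ih.symm (hT.diff_pair d))
      · rwa [swapOn_of_notMem hx]
  -- After `orderOf` steps the walk is back at `d`.
  have h1 := key (orderOf (contour hT) - 1)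
  rw [Nat.sub_add_cancel (orderOf_pos _), pow_orderOf_eq_one] at h1
  exact hac d hd (h1.symm (hT.diff_pair d))

theorem contour_sameCycle {T : Set m.Dart} (hT : m.IsSpanningTree T) (x y : m.Dart) :
    (contour hT.1).SameCycle x y := by
  have h1 (x) : (contour hT.1).SameCycle x (m.swapOn T x) := by
    by_cases hx : x ∈ T
    · rw [swapOn_of_mem hx]
      exact contour_sameCycle_α hT.1 hT.2.2 hx
    · rw [swapOn_of_notMem hx]
  have h2 (x) : (contour hT.1).SameCycle x (m.σ x) := by
    refine (h1 x).trans ?_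
    have := contour_apply hT.1 (m.swapOn T x)
    rw [swapOn_involutive hT.1 x] at this
    rw [← this]
    exact Equiv.Perm.sameCycle_apply_right.2 (.refl _ _)
  have h3 {x y} (h : m.vert x = m.vert y) : (contour hT.1).SameCycle x y :=
    (m.vert_eq_iff.1 h).invariant (P := fun y => (contour hT.1).SameCycle x y) (.refl _ _)
      fun z hz => hz.trans (h2 z)
  have h4 {u v} (h : m.Joined T u v) :
      ∀ x y, m.vert x = u → m.vert y = v → (contour hT.1).SameCycle x y := by
    induction h with
    | refl => exact fun x y hx hy => h3 (hx.trans hy.symm)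
    | tail _ h ih =>
      obtain ⟨d, hd, rfl, rfl⟩ := h
      intro x y hx hy
      exact ((ih x d hx rfl).trans (contour_sameCycle_α hT.1 hT.2.2 hd)).trans (h3 hy.symm)
  exact h4 (hT.2.1 _ _) x y rfl rfl

end CombMap

theorem Equiv.Perm.exists_equiv_finRotate {X : Type*} [Finite X] (s : Equiv.Perm X)
    (h : ∀ x y, s.SameCycle x y) (x : X) :
    ∃ (N : ℕ) (_ : NeZero N) (e : Fin N ≃ X), e 0 = x ∧ ∀ i, e (finRotate N i) = s (e i) := by
  classical
  have := Fintype.ofFinite X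
  have hs : s.IsCycleOn (Finset.univ : Finset X) := by
    rw [Finset.coe_univ]
    exact ⟨s.bijective.bijOn_univ, fun x _ y _ => h x y⟩
  have hN : NeZero (Fintype.card X) := ⟨(Fintype.card_pos_iff.2 ⟨x⟩).ne'⟩
  let g : Fin (Fintype.card X) → X := fun i => (s ^ (i : ℕ)) x
  have hg : Function.Bijective g := by
    rw [Fintype.bijective_iff_surjective_and_card]
    refine ⟨fun y => ?_, by simp⟩
    obtain ⟨n, hn, hxy⟩ := hs.exists_pow_eq (Finset.mem_univ x) (Finset.mem_univ y)
    exact ⟨⟨n, hn⟩, hxy⟩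
  refine ⟨_, hN, Equiv.ofBijective g hg, by simp [g], fun i => ?_⟩
  simp only [Equiv.ofBijective_apply, g]
  rw [← Equiv.Perm.mul_apply, ← pow_succ']
  by_cases hi : (i : ℕ) + 1 < Fintype.card X
  · rw [val_finRotate i hi]
  · have hi' : (i : ℕ) + 1 = Fintype.card X := by omega
    have h0 : finRotate _ i = 0 := by
      by_contra h0
      obtain ⟨p, hp, hpi⟩ := finRotate_pred _ h0
      have := (finRotate _).injective hpi
      subst this
      omega
    rw [h0, hi', Fin.val_zero, pow_zero, Equiv.Perm.one_apply, ← Finset.card_univ,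
      hs.pow_card_apply (Finset.mem_univ x)]

namespace ArcSystem

variable {N : ℕ} {A : ArcSystem (Fin N)}

/-- Without the edge of `x`, the contour still joins all points of `(x, α x]` to the vertex of `α
x`, and those after `α x` to the vertex of `x`. A tree arc crossing it would connect the two groups
and close a cycle. -/
theorem noncrossing_τ_of_isSpanningTree (h : A.toCombMap.IsSpanningTree A.tree) :
    Noncrossing A.τ := by
  rw [noncrossing_τ_iff]
  intro x y hx hy hxy hyx hlt
  have : NeZero N := ⟨by omega⟩
  have hstep {u} {p : Fin N} (hp : p ≠ x) (hp' : p ≠ A.α x)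
      (h : A.toCombMap.Joined (A.tree \ {x, A.α x}) u (A.vert p)) :
      A.toCombMap.Joined (A.tree \ {x, A.α x}) u (A.vert (finRotate N p)) := by
    rw [vert_finRotate]
    by_cases hpT : p ∈ A.tree
    · rw [τ_of_mem hpT]
      exact CombMap.joined_diff_α (m := A.toCombMap) hpT hp hp' h
    · rwa [τ_of_notMem hpT]
  have h1 : ∀ n : ℕ, ∀ k : Fin N, (k : ℕ) = n → x < k → k ≤ A.α x →
      A.toCombMap.Joined (A.tree \ {x, A.α x}) (A.vert (A.α x)) (A.vert k) := by
    intro n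
    induction n with
    | zero => intro k hk hxk; omega
    | succ n ih =>
      intro k hk hxk hkx
      obtain ⟨p, hp, rfl⟩ := finRotate_pred k (fun h => by simp [h] at hk)
      by_cases hpx : p = x
      · rw [vert_finRotate, hpx, τ_of_mem hx]
        exact .refl
      · exact hstep hpx (by omega) (ih p (by omega) (by omega) (by omega))
  have h2 : ∀ n : ℕ, ∀ k : Fin N, (k : ℕ) = n → A.α x < k →
      A.toCombMap.Joined (A.tree \ {x, A.α x}) (A.vert x) (A.vert k) := by
    intro n
    induction n with
    | zero => intro k hk hxk; omega
    | succ n ih =>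
      intro k hk hxk
      obtain ⟨p, hp, rfl⟩ := finRotate_pred k (fun h => by simp [h] at hk)
      by_cases hpx : p = A.α x
      · rw [vert_finRotate, hpx, τ_of_mem (A.stable x hx), A.invol]
        exact .refl
      · exact hstep (by omega) hpx (ih p (by omega) (by omega))
  have hE : A.toCombMap.IsEdgeSet (A.tree \ {x, A.α x}) := h.1.diff_pair (m := A.toCombMap) x
  have h3 := CombMap.joined_diff_α (m := A.toCombMap) hy hxy.ne' hyx.ne (h1 _ y rfl hxy hyx.le)
  exact h.2.2 x hx ((h2 _ _ rfl hlt).trans (h3.symm hE))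

end ArcSystem

theorem LabelledTreeRootedMap.exists_arcDiagram (m : LabelledTreeRootedMap) :
    ∃ (N : ℕ) (_ : NeZero N) (D : ArcDiagram (Fin N)), D.toMap.Equivalent m := by
  obtain ⟨N, hN, e, he0, he⟩ := Equiv.Perm.exists_equiv_finRotate
    (CombMap.contour m.isSpanningTree.1) (CombMap.contour_sameCycle m.isSpanningTree) m.root
  let A : ArcSystem (Fin N) :=
    { α := fun x => e.symm (m.α (e x))
      invol := fun x => by simp [m.α_invol]
      ne := fun x h => m.α_ne (e x) (by rwa [Equiv.symm_apply_eq] at h)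
      tree := e ⁻¹' m.tree
      stable := fun x hx => by simpa using m.isSpanningTree.1 _ hx }
  have hα (x : Fin N) : e (A.α x) = m.α (e x) := e.apply_symm_apply _
  have hτ (x : Fin N) : e (A.τ x) = m.swapOn m.tree (e x) := by
    by_cases hx : x ∈ A.tree
    · rw [ArcSystem.τ_of_mem hx, hα, CombMap.swapOn_of_mem hx]
    · rw [ArcSystem.τ_of_notMem hx, CombMap.swapOn_of_notMem hx]
  let f : CombMap.Iso A.toCombMap m.toCombMap :=
    { e := e
      map_σ := fun (x : Fin N) => by
        refine (he (A.τ x)).trans ?_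
        rw [CombMap.contour_apply, hτ, CombMap.swapOn_involutive m.isSpanningTree.1]
        rfl
      map_α := hα }
  have hT : e '' A.tree = m.tree := Set.image_preimage_eq _ e.surjective
  have hTs : A.toCombMap.IsSpanningTree A.tree := by
    have h1 := f.symm.isSpanningTree m.isSpanningTree
    have h2 : f.symm.e '' m.tree = A.tree := by
      rw [← hT]
      exact f.symm_image_image A.tree
    rwa [h2] at h1
  have h1 := ArcSystem.noncrossing_τ_of_isSpanningTree hTs
  have h2 := (A.isPlanar_iff h1).1 (f.symm.isPlanar m.planar)
  rw [ArcSystem.noncrossing_τ_iff] at h1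
  rw [ArcSystem.noncrossing_τ'_iff] at h2
  refine ⟨N, hN, ⟨A, fun x y hxy => ?_⟩, f, he0, hT⟩
  by_cases hx : x ∈ A.tree
  · exact h1 x y hx (hxy.1 hx)
  · exact h2 x y hx (hxy.not.1 hx)

namespace ArcDiagram

variable {N : ℕ}

/-- The isomorphism commutes with the contour, here `finRotate`, and fixes its starting point `0`,
so it is the identity. -/
theorem toMap_injective [NeZero N] {D D' : ArcDiagram (Fin N)} (h : D.toMap.Equivalent D'.toMap) :
    D = D' := by
  obtain ⟨⟨e, hσ, hα⟩, h0, hT⟩ := h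
  change Fin N ≃ Fin N at e
  replace hα : ∀ x, e (D.α x) = D'.α (e x) := hα
  replace h0 : e 0 = 0 := h0
  replace hT : e '' D.tree = D'.tree := hT
  have hmem (x : Fin N) : e x ∈ D'.tree ↔ x ∈ D.tree := by
    rw [← hT, e.injective.mem_set_image]
  have hτ (x : Fin N) : e (D.τ x) = D'.τ (e x) := by
    by_cases hx : x ∈ D.tree
    · rw [ArcSystem.τ_of_mem hx, hα, ArcSystem.τ_of_mem ((hmem x).2 hx)]
    · rw [ArcSystem.τ_of_notMem hx, ArcSystem.τ_of_notMem ((hmem x).not.2 hx)]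
  have hrot (x : Fin N) : e (finRotate N x) = finRotate N (e x) := by
    have h1 : e (finRotate N (D.τ (D.τ x))) = finRotate N (D'.τ (e (D.τ x))) := hσ (D.τ x)
    rwa [D.τ_involutive, hτ, D'.τ_involutive] at h1
  have hid : ∀ n : ℕ, ∀ x : Fin N, (x : ℕ) = n → e x = x := by
    intro n
    induction n with
    | zero => intro x hx; rw [show x = 0 from Fin.ext (by simpa using hx)]; exact h0
    | succ n ih =>
      intro x hx
      obtain ⟨p, hp, rfl⟩ := finRotate_pred x (fun h => by simp [h] at hx)
      rw [hrot, ih p (by omega)]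
  refine ArcDiagram.ext (funext fun x => ?_) (Set.ext fun x => ?_)
  · have := hα x
    rwa [hid _ _ rfl, hid _ _ rfl] at this
  · have := hmem x
    rw [hid _ _ rfl] at this
    exact this.symm

/-- The tree-rooted map with contour `D`. -/
noncomputable def toTreeRootedMap : {N : ℕ} → ArcDiagram (Fin N) → TreeRootedMap
  | 0, _ => .vertexMap
  | _ + 1, D => .ofClass (Quotient.mk _ D.toMap)

theorem two_mul_size (D : ArcDiagram (Fin N)) : 2 * D.toTreeRootedMap.size = N := by
  cases N with
  | zero => rfl
  | succ N => exact D.toArcSystem.two_mul_size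

theorem toTreeRootedMap_injective :
    Function.Injective (toTreeRootedMap : ArcDiagram (Fin N) → TreeRootedMap) := by
  intro D D' h
  cases N with
  | zero => exact ArcDiagram.ext (funext fun x => x.elim0) (Set.ext fun x => x.elim0)
  | succ N =>
    simp only [toTreeRootedMap, TreeRootedMap.ofClass.injEq] at h
    exact toMap_injective (Quotient.exact h)

theorem exists_toTreeRootedMap_eq (m : TreeRootedMap) :
    ∃ D : ArcDiagram (Fin (2 * m.size)), D.toTreeRootedMap = m := by
  have key : ∃ (N : ℕ) (D : ArcDiagram (Fin N)), D.toTreeRootedMap = m := by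
    cases m with
    | vertexMap =>
      exact ⟨0, ⟨⟨fun x => x, fun x => rfl, fun x => x.elim0, ∅, fun x => x.elim0⟩,
        fun x => x.elim0⟩, rfl⟩
    | ofClass c =>
      induction c using Quotient.inductionOn with
      | _ m =>
      obtain ⟨N, hN, D, hD⟩ := m.exists_arcDiagram
      obtain ⟨n, rfl⟩ := Nat.exists_eq_succ_of_ne_zero hN.out
      exact ⟨n + 1, D, congrArg TreeRootedMap.ofClass (Quotient.sound hD)⟩
  obtain ⟨N, D, rfl⟩ := key
  rw [D.two_mul_size]
  exact ⟨D, rfl⟩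

/-- Tree-rooted maps of size `n` are arc diagrams on `2 * n` points. -/
noncomputable def equivTreeRootedMap (n : ℕ) :
    ArcDiagram (Fin (2 * n)) ≃ {m : TreeRootedMap // m.size = n} :=
  Equiv.ofBijective (fun D => ⟨D.toTreeRootedMap, by have := D.two_mul_size; omega⟩)
    ⟨fun D D' h => toTreeRootedMap_injective (congrArg Subtype.val h), by
      rintro ⟨m, rfl⟩
      obtain ⟨D, hD⟩ := exists_toTreeRootedMap_eq m
      exact ⟨D, Subtype.ext hD⟩⟩

end ArcDiagram

/-! ### Blocks are the components of the crossing graph -/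

namespace CombMap

variable {m : CombMap}

theorem Joined.diff_or {K : Set m.Dart} {u v : m.Vertex} (d : m.Dart) (h : m.Joined K u v) :
    m.Joined (K \ {d, m.α d}) u v ∨ m.Joined K u (m.vert d) := by
  induction h with
  | refl => exact .inl .refl
  | tail h1 h2 ih =>
    obtain ⟨x, hx, rfl, rfl⟩ := h2
    by_cases hd : x = d
    · subst hd
      exact .inr h1
    by_cases hd' : x = m.α d
    · subst hd'
      have h2 := joined_α hx
      rw [m.α_invol] at h2
      exact .inr (Relation.ReflTransGen.trans h1 h2)
    · exact ih.imp_left fun h => h.trans (joined_α ⟨hx, by simp [hd, hd']⟩)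

/-- If `X` and `Y` have at most one common vertex, the part in `X` of a walk between vertices
of `Y` may be skipped. -/
theorem Joined.inter {K X Y : Set m.Dart} {v : m.Vertex} (hX : m.IsEdgeSet X) (hY : m.IsEdgeSet Y)
    (hv : ∀ w, m.IncidentTo X w → m.IncidentTo Y w → w = v) (hK : K ⊆ X ∪ Y) {a b : m.Vertex}
    (ha : m.IncidentTo Y a) (hb : m.IncidentTo Y b) (h : m.Joined K a b) :
    m.Joined (K ∩ Y) a b := by
  classical
  -- Collapsing every vertex not incident to `Y` onto `v` contracts each edge of `X` to the single
  -- vertex `v` and fixes the edges of `Y`.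
  let φ : m.Vertex → m.Vertex := fun w => if m.IncidentTo Y w then w else v
  have hφ (d : m.Dart) (hd : d ∈ X) : φ (m.vert d) = v := by
    by_cases hw : m.IncidentTo Y (m.vert d)
    · simp only [φ, if_pos hw]
      exact hv _ ⟨d, hd, rfl⟩ hw
    · simp only [φ, if_neg hw]
  have key : m.Joined (K ∩ Y) (φ a) (φ b) := by
    clear ha hb
    induction h with
    | refl => exact .refl
    | tail _ h ih =>
      obtain ⟨d, hd, rfl, rfl⟩ := h
      refine ih.trans ?_
      rcases hK hd with hdX | hdY
      · rw [hφ d hdX, hφ _ (hX d hdX)]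
      · have h1 : m.IncidentTo Y (m.vert d) := ⟨d, hdY, rfl⟩
        have h2 : m.IncidentTo Y (m.vert (m.α d)) := ⟨_, hY d hdY, rfl⟩
        simp only [φ, if_pos h1, if_pos h2]
        exact joined_α ⟨hd, hdY⟩
  simpa only [φ, if_pos ha, if_pos hb] using key

/-- A connected edge set split by `G` is separable if at most one vertex is incident both to `G`
and to its complement. -/
theorem IsSubmap.isSeparable {S G : Set m.Dart} (hS : m.IsSubmap S) (hG : m.IsEdgeSet G)
    {v : m.Vertex} (hv : ∀ x ∈ G, ∀ y ∉ G, m.vert x = m.vert y → m.vert x = v)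
    (h1 : (S ∩ G).Nonempty) (h2 : (S \ G).Nonempty) : m.IsSeparable S := by
  have hA : m.IsEdgeSet (S ∩ G) := fun d hd => ⟨hS.1 d hd.1, hG d hd.2⟩
  have hB : m.IsEdgeSet (S \ G) := fun d hd => ⟨hS.1 d hd.1, hG.mem_iff.not.2 hd.2⟩
  refine ⟨_, _, hA, hB, h1, h2, Set.disjoint_sdiff_right.mono_left Set.inter_subset_right,
    Set.inter_union_sdiff S G, ?_⟩
  have huniq (w) : m.IncidentTo (S ∩ G) w ∧ m.IncidentTo (S \ G) w → w = v := by
    rintro ⟨⟨x, hx, rfl⟩, y, hy, hxy⟩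
    exact hv x hx.2 y hy.2 hxy.symm
  obtain ⟨w, hw⟩ : ∃ w, m.IncidentTo (S ∩ G) w ∧ m.IncidentTo (S \ G) w := by
    by_contra! hc
    obtain ⟨x, hx⟩ := h1
    obtain ⟨y, hy⟩ := h2
    have hj := hS.2.2 _ _ ⟨x, hx.1, rfl⟩ ⟨y, hy.1, rfl⟩
    refine hc (m.vert y) ((hj.iff_of fun d hd => ?_).1 ⟨x, hx, rfl⟩) ⟨y, hy, rfl⟩
    by_cases hdG : d ∈ G
    · exact iff_of_true ⟨d, ⟨hd, hdG⟩, rfl⟩ ⟨_, hA d ⟨hd, hdG⟩, rfl⟩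
    · exact iff_of_false (fun h => hc _ h ⟨d, ⟨hd, hdG⟩, rfl⟩)
        (fun h => hc _ h ⟨_, hB d ⟨hd, hdG⟩, rfl⟩)
  exact ⟨w, hw, fun w' hw' => (huniq w' hw').trans (huniq w hw).symm⟩

end CombMap

namespace ArcSystem

variable {N : ℕ} (A : ArcSystem (Fin N))

/-- The tree arcs with exactly one end in `[p, q)`. -/
def leaving (p q : Fin N) : Set (Fin N) :=
  {d | d ∈ A.tree ∧ ¬ (d ∈ Set.Ico p q ↔ A.α d ∈ Set.Ico p q)}

variable {A}

theorem leaving_subset {p q q' : Fin N}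
    (h : ∀ d ∈ A.tree, d ∈ Set.Ico p q → A.α d ∉ Set.Ico p q →
      d ∈ Set.Ico p q' ∧ A.α d ∉ Set.Ico p q') : A.leaving p q ⊆ A.leaving p q' := by
  rintro d ⟨hd, hpq⟩
  refine ⟨hd, ?_⟩
  by_cases h1 : d ∈ Set.Ico p q
  · have := h d hd h1 (fun h2 => hpq (iff_of_true h1 h2))
    tauto
  · have := h (A.α d) (A.stable d hd)
    rw [A.invol d] at this
    tauto

/-- The contour from `p` to `q` follows the edges with both ends in `[p, q)` once in each direction.
Skipping these excursions leaves only the edges with one end in the interval. -/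
theorem joined_leaving (hnc : Noncrossing A.τ) {p q : Fin N} (hpq : p ≤ q) :
    A.toCombMap.Joined (A.leaving p q) (A.vert p) (A.vert q) := by
  have : NeZero N := ⟨by omega⟩
  obtain ⟨n, hn⟩ : ∃ n : ℕ, (q : ℕ) = n := ⟨_, rfl⟩
  induction n using Nat.strong_induction_on generalizing q with
  | _ n ih =>
  rcases hpq.eq_or_lt with rfl | hlt
  · exact .refl
  obtain ⟨r, hr, rfl⟩ := finRotate_pred q (fun h => by simp [h] at hlt)
  have hmem (x : Fin N) : x ∈ Set.Ico p (finRotate N r) ↔ x ∈ Set.Ico p r ∨ x = r := by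
    simp only [Set.mem_Ico]
    omega
  rw [vert_finRotate]
  by_cases hrT : r ∈ A.tree
  swap
  · rw [τ_of_notMem hrT]
    refine (ih r (by omega) (by omega) rfl).mono (leaving_subset fun d hd h1 h2 => ?_)
    rw [hmem, hmem]
    refine ⟨.inl h1, fun h => h.elim h2 ?_⟩
    rintro rfl
    exact hrT (A.stable d hd)
  rw [τ_of_mem hrT]
  -- Here `r` closes an arc opened after `p`: the excursion since `α r` is dropped. Noncrossing
  -- keeps tree arcs that leave `[p, α r)` from ending beneath it.
  by_cases hs : A.α r ∈ Set.Ico p r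
  · have h1 : A.α r < A.τ (A.α r) := by
      rw [τ_of_mem (A.stable r hrT), A.invol]
      exact hs.2
    refine (ih _ (by have := hs.2; omega) hs.1 rfl).mono (leaving_subset fun d hd h2 h3 => ?_)
    rw [hmem, hmem]
    refine ⟨.inl ⟨h2.1, h2.2.trans hs.2⟩, ?_⟩
    have hd1 : A.α d ≠ A.α r := fun h => by
      rw [A.invol.injective h] at h2
      exact h2.2.not_gt hs.2
    have hd2 : A.α d ≠ r := fun h => by
      rw [← h, A.invol d] at h2
      exact h2.2.false
    have h4 := hnc.interval A.τ_involutive (a := A.α r) (x := A.α d)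
    rw [τ_of_mem (A.stable r hrT), A.invol, τ_of_mem (A.stable d hd), A.invol] at h4
    simp only [Set.mem_Ico] at h2 h3 ⊢
    omega
  · refine ((ih r (by omega) (by omega) rfl).mono (leaving_subset fun d hd h1 h2 => ?_)).trans
      (CombMap.joined_α (m := A.toCombMap) (d := r) ⟨hrT, ?_⟩)
    · rw [hmem, hmem]
      refine ⟨.inl h1, fun h => h.elim h2 fun h => hs ?_⟩
      rwa [show A.α r = d by rw [← h, A.invol d]]
    · rw [hmem, hmem]
      have := A.ne r
      tauto

theorem leaving_subset_comp {e : Fin N} (he : e ∉ A.tree) :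
    A.leaving e (A.α e) ⊆ {d | A.comp e d} := by
  rintro d ⟨hd, h⟩
  by_contra hc
  apply h
  have h1 : e ≠ d := by rintro rfl; exact he hd
  have h2 : e ≠ A.α d := by rintro rfl; exact he (A.stable d hd)
  have hc' : ¬ A.comp e (A.α d) := fun h => hc (A.comp.trans h (A.comp.symm (comp_α d)))
  have h3 := fun h => interval_of_not_comp hc h
  have h4 := fun h => interval_of_not_comp hc' h
  rw [A.invol d] at h4
  simp only [Set.mem_Ico]
  omega

theorem not_joined_of_crosses (hnc : Noncrossing A.τ) {d e : Fin N} (hd : d ∈ A.tree)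
    (h : A.Crosses d e ∨ A.Crosses e d) :
    ¬ A.toCombMap.Joined (A.tree \ {d, A.α d}) (A.vert e) (A.vert (A.α e)) := by
  intro hj
  have hda : d < A.α d := by
    rcases h with h | h
    · exact h.1.trans h.2.1
    · exact h.2.1.trans h.2.2
  have := A.joined_diff_mem_iff hnc hd hda hj
  rcases h with ⟨h1, h2, h3⟩ | ⟨h1, h2, h3⟩ <;> omega

end ArcSystem

namespace ArcDiagram

open ArcSystem

variable {N : ℕ} (D : ArcDiagram (Fin N))

theorem joined_leaving_of_crosses {d e : Fin N} (h : D.Crosses d e ∨ D.Crosses e d) :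
    D.toCombMap.Joined (D.leaving e (D.α e)) (D.vert e) (D.vert (D.α e)) := by
  refine joined_leaving D.noncrossing_τ ?_
  rcases h with h | h
  · exact (h.2.1.trans h.2.2).le
  · exact (h.1.trans h.2.1).le

variable {D}

theorem tree_xor_of_crosses {x y : Fin N} (h : D.Crosses x y) :
    x ∈ D.tree ∧ y ∉ D.tree ∨ x ∉ D.tree ∧ y ∈ D.tree := by
  have := D.noncross x y
  have := h.1
  have := h.2.1
  have := h.2.2
  tauto

/-- The tree path between the ends of `e` uses only arcs crossing `e`, and must pass through `d`,
whose removal separates these ends. -/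
theorem joined_of_crosses {d e c : Fin N} (hd : d ∈ D.tree) (he : e ∉ D.tree)
    (h : D.Crosses d e ∨ D.Crosses e d) (hc : D.comp e c) :
    D.toCombMap.Joined {x | D.comp x c} (D.vert e) (D.vert d) := by
  rcases (D.joined_leaving_of_crosses h).diff_or (m := D.toCombMap) d with h1 | h1
  · refine absurd (h1.mono ?_) (not_joined_of_crosses D.noncrossing_τ hd h)
    exact Set.sdiff_subset_sdiff_left fun x hx => hx.1
  · exact h1.mono (show D.leaving e (D.α e) ⊆ {x | D.comp x c} from
      fun x hx => D.comp.trans (D.comp.symm (leaving_subset_comp he hx)) hc)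

theorem isSubmap_comp (c : Fin N) : D.toCombMap.IsSubmap {x | D.comp x c} := by
  have hE : D.toCombMap.IsEdgeSet {x | D.comp x c} :=
    fun (x : Fin N) hx => D.comp.trans (D.comp.symm (comp_α x)) hx
  refine ⟨hE, ⟨c, D.comp.refl c⟩, ?_⟩
  rintro _ _ ⟨x : Fin N, hx : D.comp x c, rfl⟩ ⟨y : Fin N, hy : D.comp y c, rfl⟩
  have hcr {z w : Fin N} (h : D.Crosses z w) (hz : D.comp z c) :
      D.toCombMap.Joined {x | D.comp x c} (D.vert z) (D.vert w) := by
    have hw : D.comp w c := D.comp.trans (D.comp.symm h.comp) hz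
    rcases tree_xor_of_crosses h with ⟨h1, h2⟩ | ⟨h1, h2⟩
    · exact (joined_of_crosses h1 h2 (.inl h) hw).symm hE
    · exact joined_of_crosses h2 h1 (.inr h) hz
  have key := comp_iff_of (A := D.toArcSystem) (P := fun z => D.comp z c ∧
    D.toCombMap.Joined {x | D.comp x c} (D.vert x) (D.vert z)) ?_ ?_
    (D.comp.trans hx (D.comp.symm hy))
  · exact (key.1 ⟨hx, .refl⟩).2
  · rintro z ⟨h1, h2⟩
    exact ⟨hE z h1, h2.trans (CombMap.joined_α (m := D.toCombMap) (d := z) h1)⟩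
  · intro z w h
    constructor
    · rintro ⟨h1, h2⟩
      exact ⟨D.comp.trans (D.comp.symm h.comp) h1, h2.trans (hcr h h1)⟩
    · rintro ⟨h1, h2⟩
      have hz := D.comp.trans h.comp h1
      exact ⟨hz, h2.trans ((hcr h hz).symm hE)⟩

/-- If a tree arc `d` and a crossing arc `e` lay in different parts, dropping the part of `d` from
the tree path between the ends of `e` would give a path avoiding `d`. So crossing arcs lie in the
same part, and the other part is empty. -/
theorem not_isSeparable_comp (c : Fin N) : ¬ D.toCombMap.IsSeparable {x | D.comp x c} := by
  rintro ⟨A, B, hA, hB, ⟨a, ha⟩, ⟨b, hb⟩, hdis, hAB, v, -, hv⟩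
  have hnot {X Y : Set (Fin N)} (hX : D.toCombMap.IsEdgeSet X) (hY : D.toCombMap.IsEdgeSet Y)
      (hXY : Disjoint X Y) (hC : X ∪ Y = {x | D.comp x c})
      (hv : ∀ w, D.toCombMap.IncidentTo X w → D.toCombMap.IncidentTo Y w → w = v)
      {d e : Fin N} (hdX : d ∈ X) (heY : e ∈ Y) (hd : d ∈ D.tree) (he : e ∉ D.tree)
      (h : D.Crosses d e ∨ D.Crosses e d) : False := by
    have hec : D.comp e c := hC.subset (.inr heY)
    have hsub : D.leaving e (D.α e) ⊆ X ∪ Y := by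
      rw [hC]
      exact fun x hx => D.comp.trans (D.comp.symm (leaving_subset_comp he hx)) hec
    have h1 := (D.joined_leaving_of_crosses h).inter (m := D.toCombMap) hX hY hv hsub
      ⟨e, heY, rfl⟩ ⟨D.α e, hY e heY, rfl⟩
    refine not_joined_of_crosses D.noncrossing_τ hd h (h1.mono ?_)
    rintro x ⟨hx, hxY⟩
    refine ⟨hx.1, ?_⟩
    rintro (rfl | rfl)
    · exact Set.disjoint_left.1 hXY hdX hxY
    · exact Set.disjoint_left.1 hXY (hX d hdX) hxY
  have hac : D.comp a c := hAB.subset (.inl ha)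
  have hbc : D.comp b c := hAB.subset (.inr hb)
  have hcr (x y : Fin N) (h : D.Crosses x y) : x ∈ A ↔ y ∈ A := by
    by_contra hne
    have h1 : (x ∈ A ∧ y ∈ B) ∨ (x ∈ B ∧ y ∈ A) := by
      by_cases hx : x ∈ A
      · have hy : y ∈ A ∪ B :=
          hAB.superset (D.comp.trans (D.comp.symm h.comp) (hAB.subset (.inl hx)))
        exact .inl ⟨hx, hy.resolve_left fun hy => hne (iff_of_true hx hy)⟩
      · have hy : y ∈ A := by
          by_contra hy
          exact hne (iff_of_false hx hy)
        have hx' : x ∈ A ∪ B := hAB.superset (D.comp.trans h.comp (hAB.subset (.inl hy)))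
        exact .inr ⟨hx'.resolve_left hx, hy⟩
    have hBA : B ∪ A = {x | D.comp x c} := by rw [Set.union_comm]; exact hAB
    have hn1 := fun {d e} => hnot (d := d) (e := e) hA hB hdis hAB fun w h h' => hv w ⟨h, h'⟩
    have hn2 := fun {d e} => hnot (d := d) (e := e) hB hA hdis.symm hBA fun w h h' => hv w ⟨h', h⟩
    rcases tree_xor_of_crosses h with ⟨hx, hy⟩ | ⟨hx, hy⟩ <;> rcases h1 with ⟨h1, h2⟩ | ⟨h1, h2⟩
    · exact hn1 h1 h2 hx hy (.inl h)
    · exact hn2 h1 h2 hx hy (.inl h)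
    · exact hn2 h2 h1 hy hx (.inr h)
    · exact hn1 h2 h1 hy hx (.inr h)
  have hbA := (comp_iff_of (A := D.toArcSystem) (P := fun x => x ∈ A) hA hcr
    (D.comp.trans hac (D.comp.symm hbc))).1 ha
  exact Set.disjoint_left.1 hdis hbA hb

/-- At most one vertex is incident both to a stable interval and to its complement. -/
theorem exists_vert_eq_of_ordConnected {G : Set (Fin N)} (hG : G.OrdConnected)
    (hs : ∀ x ∈ G, D.α x ∈ G) (hne : G.Nonempty) :
    ∃ v, ∀ x ∈ G, ∀ y ∉ G, D.vert x = D.vert y → D.vert x = v := by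
  obtain ⟨r, hr⟩ := G.toFinite.exists_maximal hne
  refine ⟨D.vert (D.τ r), fun x hx y hy hxy => ?_⟩
  by_contra hc
  -- The rotation `z ↦ τ z + 1` can leave the interval only from `τ z = r`, its last point, hence
  -- only at the vertex of `τ r`.
  have key := (D.vert_eq_iff.1 hxy).invariant
    (P := fun z => z ∈ G ∧ D.vert z ≠ D.vert (D.τ r)) ⟨hx, hc⟩ ?_
  · exact hy key.1
  rintro z ⟨hz, hzr⟩
  have hτ : D.τ z ∈ G := by
    by_cases h : z ∈ D.tree
    · rw [τ_of_mem h]; exact hs z hz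
    · rwa [τ_of_notMem h]
  have hlt : D.τ z < r := by
    rcases lt_trichotomy (D.τ z) r with h | h | h
    · exact h
    · rw [← h, D.τ_involutive] at hzr
      exact absurd rfl hzr
    · exact absurd (hr.2 hτ h.le) h.not_ge
  rw [rotPerm_apply]
  have hval := val_finRotate_of_lt hlt
  refine ⟨hG.out hτ hr.prop ⟨by omega, by omega⟩, ?_⟩
  rwa [vert_finRotate, D.τ_involutive]

theorem comp_of_not_isSeparable {S : Set (Fin N)} (hS : D.toCombMap.IsSubmap S)
    (hsep : ¬ D.toCombMap.IsSeparable S) {x y : Fin N} (hx : x ∈ S) (hy : y ∈ S) :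
    D.comp x y := by
  by_contra hc
  obtain ⟨G, hG, hs, h⟩ := exists_separating hc
  obtain ⟨v, hv⟩ := exists_vert_eq_of_ordConnected hG hs (h.elim (fun h => ⟨x, h.1⟩)
    (fun h => ⟨y, h.2⟩))
  refine hsep (hS.isSeparable (m := D.toCombMap) hs hv ?_ ?_)
  · exact h.elim (fun h => ⟨x, hx, h.1⟩) (fun h => ⟨y, hy, h.2⟩)
  · exact h.elim (fun h => ⟨y, hy, h.2⟩) (fun h => ⟨x, hx, h.1⟩)

theorem isBlock_iff {S : Set (Fin N)} : D.toCombMap.IsBlock S ↔ S ∈ D.comp.classes := by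
  constructor
  · intro h
    obtain ⟨c, hc⟩ := h.prop.1.2.1
    refine ⟨c, Set.Subset.antisymm
      (fun x hx => comp_of_not_isSeparable h.prop.1 h.prop.2 hx hc) ?_⟩
    exact h.le_of_ge ⟨isSubmap_comp c, not_isSeparable_comp c⟩
      fun x hx => comp_of_not_isSeparable h.prop.1 h.prop.2 hx hc
  · rintro ⟨c, rfl⟩
    refine ⟨⟨isSubmap_comp c, not_isSeparable_comp c⟩, fun S hS hle x hx => ?_⟩
    exact comp_of_not_isSeparable hS.1 hS.2 hx (hle (D.comp.refl c))

theorem numBlocks_eq (D : ArcDiagram (Fin N)) :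
    D.toTreeRootedMap.numBlocks = Nat.card (Quotient D.comp) := by
  cases N with
  | zero =>
    have : IsEmpty (Quotient D.comp) := ⟨fun q => q.inductionOn fun x => x.elim0⟩
    rw [Nat.card_of_isEmpty]
    rfl
  | succ N =>
    rw [Nat.card_congr (Setoid.quotientEquivClasses D.comp)]
    exact Nat.card_congr (Equiv.subtypeEquivRight fun S => isBlock_iff)

theorem isTwoConnected_iff (D : ArcDiagram (Fin N)) :
    D.toTreeRootedMap.IsTwoConnected ↔ ∀ x y, D.comp x y := by
  cases N with
  | zero => exact iff_of_true trivial fun x => x.elim0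
  | succ N =>
    change ¬ D.toCombMap.IsSeparable Set.univ ↔ _
    constructor
    · intro h x y
      refine comp_of_not_isSeparable (S := Set.univ) ⟨fun _ _ => trivial, ⟨x, trivial⟩, ?_⟩ h
        trivial trivial
      exact fun u v _ _ => (D.tree_joined u v).mono (Set.subset_univ _)
    · intro h
      have h1 : ({x | D.comp x 0} : Set (Fin (N + 1))) = Set.univ :=
        Set.eq_univ_of_forall fun x => h x 0
      have h2 : ∀ S : Set (Fin (N + 1)), S = {x | D.comp x 0} → ¬ D.toCombMap.IsSeparable S := by
        rintro _ rfl
        exact not_isSeparable_comp 0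
      exact h2 _ h1.symm

end ArcDiagram

/-! ### Counting arc diagrams; transport and gluing -/

namespace ArcDiagram

open ArcSystem

instance {L : Type} [LinearOrder L] [Finite L] : Finite (ArcDiagram L) :=
  Finite.of_injective (fun D : ArcDiagram L => (D.α, D.tree)) fun _ _ h =>
    ArcDiagram.ext (congrArg Prod.fst h) (congrArg Prod.snd h)

noncomputable instance {L : Type} [LinearOrder L] [Finite L] : Fintype (ArcDiagram L) :=
  Fintype.ofFinite _

section map

variable {L L' : Type} [LinearOrder L] [LinearOrder L']

/-- Transport of an arc diagram along an order isomorphism. -/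
def map (e : L ≃o L') (D : ArcDiagram L) : ArcDiagram L' where
  α x := e (D.α (e.symm x))
  invol x := by simp [D.invol (e.symm x)]
  ne x h := D.ne (e.symm x) (e.injective (h.trans (e.apply_symm_apply x).symm))
  tree := e.symm ⁻¹' D.tree
  stable x hx := by simpa using D.stable _ hx
  noncross x y hxy h1 h2 h3 := D.noncross (e.symm x) (e.symm y) hxy (by simpa using h1)
    (by rwa [e.symm_apply_lt]) (by simpa using h3)

theorem map_α (e : L ≃o L') (D : ArcDiagram L) (x : L) : (D.map e).α (e x) = e (D.α x) := by
  simp [map]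

theorem map_symm_map (e : L ≃o L') (D : ArcDiagram L) : (D.map e).map e.symm = D :=
  ArcDiagram.ext (funext fun x => by simp [map]) (Set.ext fun x => by simp [map])

theorem comp_map (e : L ≃o L') {D : ArcDiagram L} {x y : L} (h : D.comp x y) :
    (D.map e).comp (e x) (e y) := by
  refine (comp_iff_of (A := D.toArcSystem) (P := fun z => (D.map e).comp (e x) (e z))
    ?_ ?_ h).1 (Setoid.refl' _ _)
  · intro z hz
    rw [← map_α]
    exact Setoid.trans' _ hz (comp_α _)
  · intro z w ⟨h1, h2, h3⟩
    have hzw : (D.map e).comp (e z) (e w) := Crosses.comp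
      ⟨e.lt_iff_lt.2 h1, by rw [map_α]; exact e.lt_iff_lt.2 h2,
        by rw [map_α, map_α]; exact e.lt_iff_lt.2 h3⟩
    exact ⟨fun h => Setoid.trans' _ h hzw, fun h => Setoid.trans' _ h (Setoid.symm' _ hzw)⟩

theorem comp_map_iff (e : L ≃o L') {D : ArcDiagram L} {x y : L} :
    (D.map e).comp (e x) (e y) ↔ D.comp x y := by
  refine ⟨fun h => ?_, comp_map e⟩
  have := comp_map e.symm h
  rwa [map_symm_map, e.symm_apply_apply, e.symm_apply_apply] at this

/-- Order isomorphisms induce equivalences of arc diagrams. -/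
def mapEquiv (e : L ≃o L') : ArcDiagram L ≃ ArcDiagram L' where
  toFun := map e
  invFun := map e.symm
  left_inv := map_symm_map e
  right_inv := map_symm_map e.symm

theorem card_quotient_map (e : L ≃o L') (D : ArcDiagram L) :
    Nat.card (Quotient (D.map e).comp) = Nat.card (Quotient D.comp) :=
  (Nat.card_congr (Quotient.congr e.toEquiv fun _ _ => (comp_map_iff e).symm)).symm

theorem forall_comp_map_iff (e : L ≃o L') (D : ArcDiagram L) :
    (∀ x y, (D.map e).comp x y) ↔ ∀ x y, D.comp x y := by
  rw [e.surjective.forall₂]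
  exact forall₂_congr fun x y => comp_map_iff e

end map

open Polynomial in
/-- The generating polynomial of arc diagrams by number of components. -/
noncomputable def compPoly (L : Type) [LinearOrder L] [Finite L] : ℤ[X] :=
  ∑ D : ArcDiagram L, X ^ Nat.card (Quotient D.comp)

/-- The number of arc diagrams with at most one component. -/
noncomputable def connCount (L : Type) [LinearOrder L] : ℕ :=
  Nat.card {D : ArcDiagram L // ∀ x y, D.comp x y}

theorem compPoly_eq_fin (L : Type) [LinearOrder L] [Finite L] :
    compPoly L = compPoly (Fin (Nat.card L)) := by
  have := Fintype.ofFinite L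
  have e : L ≃o Fin (Nat.card L) := (Fintype.orderIsoFinOfCardEq L (Nat.card_eq_fintype_card).symm).symm
  exact Fintype.sum_equiv (mapEquiv e) _ _ fun D => by
    rw [← card_quotient_map e D]; rfl

theorem connCount_eq_fin (L : Type) [LinearOrder L] [Finite L] :
    connCount L = connCount (Fin (Nat.card L)) := by
  have := Fintype.ofFinite L
  have e : L ≃o Fin (Nat.card L) := (Fintype.orderIsoFinOfCardEq L (Nat.card_eq_fintype_card).symm).symm
  exact Nat.card_congr ((mapEquiv e).subtypeEquiv fun D => (forall_comp_map_iff e D).symm)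

-- On a nonempty order a connected diagram has exactly one component, whence the single factor `X`.
open Polynomial in
open Classical in
theorem sum_connected (L : Type) [LinearOrder L] [Finite L] [Nonempty L] :
    ∑ D : ArcDiagram L, (if ∀ x y, D.comp x y then (X : ℤ[X]) ^ Nat.card (Quotient D.comp) else 0) =
      (connCount L : ℤ[X]) * X := by
  have h (D : ArcDiagram L) : (if ∀ x y, D.comp x y then
      (X : ℤ[X]) ^ Nat.card (Quotient D.comp) else 0) = if ∀ x y, D.comp x y then X else 0 := by
    split_ifs with hD
    · have : Subsingleton (Quotient D.comp) :=
        ⟨fun a b => Quotient.inductionOn₂ a b fun x y => Quotient.sound (hD x y)⟩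
      have : Nonempty (Quotient D.comp) := ⟨Quotient.mk _ (Classical.arbitrary L)⟩
      rw [Nat.card_unique, pow_one]
    · rfl
  rw [Finset.sum_congr rfl fun D _ => h D, Finset.sum_ite, Finset.sum_const_zero, add_zero,
    Finset.sum_const, nsmul_eq_mul, connCount, Nat.card_eq_fintype_card, Fintype.card_subtype]

section glue

variable {L I : Type} [LinearOrder L] {p : L → I}

/-- The fibres of `p` form a noncrossing partition. -/
def NoncrossingFibres (p : L → I) : Prop :=
  ∀ x y x' y', x < y → y < x' → x' < y' → p x = p x' → p y = p y' → p x = p y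

/-- The union of arc diagrams on the parts of a noncrossing partition. -/
def glue (hp : NoncrossingFibres p) (F : ∀ i, ArcDiagram {x // p x = i}) : ArcDiagram L where
  α x := (F (p x)).α ⟨x, rfl⟩
  invol x := by
    have key : ∀ i (z : {x // p x = i}), ((F (p z.1)).α ⟨z.1, rfl⟩ : L) = (F i).α z := by
      rintro _ ⟨z, rfl⟩
      rfl
    refine (key (p x) _).trans ?_
    rw [(F (p x)).invol]
  ne x h := (F (p x)).ne _ (Subtype.ext h)
  tree := {x | (⟨x, rfl⟩ : {y // p y = p x}) ∈ (F (p x)).tree}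
  stable x hx := by
    have key : ∀ i (z : {x // p x = i}), z ∈ (F i).tree → ⟨z.1, rfl⟩ ∈ (F (p z.1)).tree := by
      rintro _ ⟨z, rfl⟩ h
      exact h
    exact key _ _ ((F (p x)).stable _ hx)
  noncross x y hxy h1 h2 h3 := by
    have hpx := ((F (p x)).α ⟨x, rfl⟩).2
    have hpy := ((F (p y)).α ⟨y, rfl⟩).2
    have hp' := hp _ _ _ _ h1 h2 h3 hpx.symm hpy.symm
    -- Both points lie in the same part. Naming it `i` brings the diagrams over `p x` and `p y`,
    -- equal only propositionally, to the same `F i`.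
    obtain ⟨i, hi⟩ : ∃ i, p x = i := ⟨_, rfl⟩
    have hj : p y = i := hp'.symm.trans hi
    have key : ∀ (z : L) (hz : p z = i), ((F (p z)).α ⟨z, rfl⟩ : L) = (F i).α ⟨z, hz⟩ ∧
        ((⟨z, rfl⟩ : {y // p y = p z}) ∈ (F (p z)).tree ↔ ⟨z, hz⟩ ∈ (F i).tree) := by
      rintro z rfl
      exact ⟨rfl, Iff.rfl⟩
    rw [(key x hi).1] at h2 h3
    rw [(key y hj).1] at h3
    rw [Set.mem_ofPred, Set.mem_ofPred, (key x hi).2, (key y hj).2] at hxy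
    exact (F i).noncross ⟨x, hi⟩ ⟨y, hj⟩ hxy h1 h2 h3

variable {hp : NoncrossingFibres p} {F : ∀ i, ArcDiagram {x // p x = i}}

theorem glue_α {i : I} (z : {x // p x = i}) : (glue hp F).α z = (F i).α z := by
  obtain ⟨z, rfl⟩ := z
  rfl

theorem mem_tree_glue {i : I} (z : {x // p x = i}) : z.1 ∈ (glue hp F).tree ↔ z ∈ (F i).tree := by
  obtain ⟨z, rfl⟩ := z
  rfl

theorem apply_glue_α (x : L) : p ((glue hp F).α x) = p x := ((F (p x)).α ⟨x, rfl⟩).2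

theorem glue_injective (hp : NoncrossingFibres p) : Function.Injective (glue hp) := by
  intro F F' h
  funext i
  refine ArcDiagram.ext (funext fun z => Subtype.ext ?_) (Set.ext fun z => ?_)
  · rw [← glue_α (hp := hp), h, glue_α]
  · rw [← mem_tree_glue (hp := hp), h, mem_tree_glue]

theorem exists_glue_eq (hp : NoncrossingFibres p) (D : ArcDiagram L)
    (hD : ∀ x, p (D.α x) = p x) : ∃ F, glue hp F = D :=
  ⟨fun _ =>
    { α := fun z => ⟨D.α z, (hD z).trans z.2⟩
      invol := fun z => Subtype.ext (D.invol z)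
      ne := fun z h => D.ne z (congrArg Subtype.val h)
      tree := Subtype.val ⁻¹' D.tree
      stable := fun z hz => D.stable z hz
      noncross := fun x y => D.noncross x y }, rfl⟩

theorem Crosses_apply_eq {D : ArcDiagram L} (hp : NoncrossingFibres p)
    (hD : ∀ x, p (D.α x) = p x) {x y : L} (h : D.Crosses x y) : p x = p y :=
  hp _ _ _ _ h.1 h.2.1 h.2.2 (hD x).symm (hD y).symm

theorem comp_apply_eq {D : ArcDiagram L} (hp : NoncrossingFibres p)
    (hD : ∀ x, p (D.α x) = p x) {x y : L} (h : D.comp x y) : p x = p y :=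
  ((comp_iff_of (A := D.toArcSystem) (P := fun z => p x = p z) (fun z hz => hz.trans (hD z).symm)
    (fun z w hzw => by rw [Crosses_apply_eq hp hD hzw]) h).1 rfl)

/-- Arcs of different parts never cross, so no chain of crossings leaves a part. -/
theorem comp_glue_iff {i : I} {x y : {x // p x = i}} :
    (glue hp F).comp x y ↔ (F i).comp x y := by
  have hcr {z w : {x // p x = i}} : (glue hp F).Crosses z w ↔ (F i).Crosses z w := by
    simp only [ArcSystem.Crosses, glue_α, Subtype.coe_lt_coe]
  constructor
  · intro h
    have := (comp_iff_of (A := (glue hp F).toArcSystem)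
      (P := fun z => ∃ hz : p z = i, (F i).comp x ⟨z, hz⟩) ?_ ?_ h).1 ⟨x.2, Setoid.refl' _ _⟩
    · exact this.2
    · rintro z ⟨hz, hxz⟩
      have h1 := glue_α (hp := hp) (F := F) ⟨z, hz⟩
      refine ⟨(apply_glue_α z).trans hz, Setoid.trans' _ hxz ?_⟩
      have h2 := comp_α (A := (F i).toArcSystem) ⟨z, hz⟩
      rwa [← show (⟨(glue hp F).α z, (apply_glue_α z).trans hz⟩ : {x // p x = i}) =
        (F i).α ⟨z, hz⟩ from Subtype.ext h1] at h2
    · intro z w hzw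
      have hpzw := Crosses_apply_eq hp apply_glue_α hzw
      constructor
      · rintro ⟨hz, hxz⟩
        have hw := hpzw.symm.trans hz
        exact ⟨hw, Setoid.trans' _ hxz ((hcr (z := ⟨z, hz⟩) (w := ⟨w, hw⟩)).1 hzw).comp⟩
      · rintro ⟨hw, hxw⟩
        have hz := hpzw.trans hw
        exact ⟨hz, Setoid.trans' _ hxw
          (Setoid.symm' _ ((hcr (z := ⟨z, hz⟩) (w := ⟨w, hw⟩)).1 hzw).comp)⟩
  · intro h
    refine (comp_iff_of (A := (F i).toArcSystem) (P := fun z => (glue hp F).comp x z) ?_ ?_ h).1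
      (Setoid.refl' _ _)
    · intro z hz
      rw [← glue_α (hp := hp)]
      exact Setoid.trans' _ hz (comp_α _)
    · intro z w hzw
      have := (hcr.2 hzw).comp
      exact ⟨fun h => Setoid.trans' _ h this, fun h => Setoid.trans' _ h (Setoid.symm' _ this)⟩

theorem card_quotient_glue [Finite L] [Fintype I] :
    Nat.card (Quotient (glue hp F).comp) = ∑ i, Nat.card (Quotient (F i).comp) := by
  rw [← Nat.card_sigma]
  symm
  refine Nat.card_congr (Equiv.ofBijective
    (fun q : Σ i, Quotient (F i).comp => (Quotient.map' Subtype.val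
      (fun x y h => comp_glue_iff.2 h) q.2 : Quotient (glue hp F).comp)) ⟨?_, ?_⟩)
  · rintro ⟨i, ⟨x⟩⟩ ⟨j, ⟨y⟩⟩ h
    have h1 : (glue hp F).comp x.1 y.1 := Quotient.exact h
    have h2 := comp_apply_eq hp apply_glue_α h1
    rw [x.2, y.2] at h2
    subst h2
    exact congrArg (Sigma.mk i) (Quotient.sound (comp_glue_iff.1 h1))
  · rintro ⟨x⟩
    exact ⟨⟨p x, Quotient.mk _ ⟨x, rfl⟩⟩, rfl⟩

end glue

end ArcDiagram

/-! ### Compositions as noncrossing partitions -/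

namespace Composition

variable {N : ℕ} (c : Composition N)

/-- The partition of `Fin N` into the set of first elements of the blocks (`none`) and, for each
block, the set of its other elements. -/
def part (x : Fin N) : Option (Fin c.length) :=
  if (x : ℕ) = c.sizeUpTo (c.index x) then none else some (c.index x)

variable {c}

theorem part_eq_none {x : Fin N} : c.part x = none ↔ (x : ℕ) = c.sizeUpTo (c.index x) := by
  simp [part]

theorem part_eq_some {x : Fin N} {i : Fin c.length} :
    c.part x = some i ↔ c.index x = i ∧ c.sizeUpTo i < x := by
  have := c.sizeUpTo_index_le x
  unfold part
  split_ifs with h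
  · refine iff_of_false (by simp) ?_
    rintro ⟨rfl, h'⟩
    omega
  · rw [Option.some.injEq]
    refine ⟨?_, fun h => h.1⟩
    rintro rfl
    exact ⟨rfl, by omega⟩

variable (c)

theorem index_mono : Monotone c.index := by
  intro x y hxy
  by_contra hlt
  have h1 := c.lt_sizeUpTo_index_succ y
  have h2 := c.sizeUpTo_index_le x
  have h3 : c.sizeUpTo (c.index y).succ ≤ c.sizeUpTo (c.index x) :=
    c.monotone_sizeUpTo (by rw [Fin.val_succ]; omega)
  omega

/-- Two non-initial points of a block enclose only non-initial points of that block. -/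
theorem noncrossingFibres_part : ArcDiagram.NoncrossingFibres c.part := by
  intro x y x' y' h1 h2 h3 hx hy
  cases hi : c.part x with
  | some i =>
    have hi' := hx.symm.trans hi
    rw [part_eq_some] at hi hi'
    have h4 := c.index_mono h1.le
    have h5 := c.index_mono h2.le
    rw [hi.1] at h4
    rw [hi'.1] at h5
    exact (part_eq_some.2 ⟨le_antisymm h5 h4, hi.2.trans h1⟩).symm
  | none =>
    have hi' := hx.symm.trans hi
    rw [part_eq_none] at hi'
    cases hj : c.part y with
    | none => rfl
    | some j =>
      have hj' := hy.symm.trans hj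
      rw [part_eq_some] at hj hj'
      have h4 := c.index_mono h2.le
      have h5 := c.index_mono h3.le
      rw [hj.1] at h4
      rw [hj'.1] at h5
      rw [le_antisymm h5 h4] at hi'
      omega

theorem card_part_none : Nat.card {x // c.part x = none} = c.length := by
  refine Eq.trans ?_ (Nat.card_fin c.length)
  refine (Nat.card_congr (Equiv.ofBijective (fun i : Fin c.length =>
    (⟨c.embedding i ⟨0, c.one_le_blocksFun i⟩, ?_⟩ : {x // c.part x = none})) ⟨?_, ?_⟩)).symm
  · rw [part_eq_none, index_embedding, coe_embedding]
    rfl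
  · intro i j h
    have := congrArg (fun x => c.index x.1) h
    simpa only [index_embedding] using this
  · rintro ⟨x, hx⟩
    refine ⟨c.index x, Subtype.ext (Fin.ext ?_)⟩
    rw [part_eq_none] at hx
    rw [coe_embedding, ← hx]
    rfl

theorem card_part_some (i : Fin c.length) :
    Nat.card {x // c.part x = some i} = c.blocksFun i - 1 := by
  rw [← Nat.card_fin (c.blocksFun i - 1)]
  refine (Nat.card_congr (Equiv.ofBijective (fun j : Fin (c.blocksFun i - 1) =>
    (⟨c.embedding i ⟨j + 1, by omega⟩, ?_⟩ : {x // c.part x = some i})) ⟨?_, ?_⟩)).symm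
  · rw [part_eq_some, index_embedding, coe_embedding]
    simp
  · intro j k h
    have h1 : ((c.embedding i ⟨j + 1, by omega⟩ : Fin N) : ℕ) = c.embedding i ⟨k + 1, by omega⟩ :=
      congrArg (fun x => (x.1 : ℕ)) h
    rw [coe_embedding, coe_embedding] at h1
    simp only [Fin.ext_iff] at *
    omega
  · rintro ⟨x, hx⟩
    rw [part_eq_some] at hx
    have h1 := c.lt_sizeUpTo_index_succ x
    rw [hx.1, Fin.val_succ, sizeUpTo_succ'] at h1
    refine ⟨⟨x - c.sizeUpTo i - 1, by omega⟩, Subtype.ext (Fin.ext ?_)⟩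
    rw [coe_embedding]
    simp only
    omega

theorem castSucc_mem_boundaries_iff (x : Fin N) : x.castSucc ∈ c.boundaries ↔ c.part x = none := by
  rw [part_eq_none, boundaries, Finset.mem_map]
  constructor
  · rintro ⟨i, -, hi⟩
    have hi' : c.sizeUpTo i = x := congrArg Fin.val hi
    have hlt : (i : ℕ) < c.length := by
      by_contra h
      rw [c.sizeUpTo_ofLength_le _ (not_lt.1 h)] at hi'
      omega
    have hx : x = c.embedding ⟨i, hlt⟩ ⟨0, c.one_le_blocksFun _⟩ :=
      Fin.ext (by rw [coe_embedding]; exact hi'.symm)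
    have h2 : c.index x = ⟨i, hlt⟩ := by rw [hx, index_embedding]
    rw [h2]
    exact hi'.symm
  · intro h
    exact ⟨(c.index x).castSucc, Finset.mem_univ _, Fin.ext h.symm⟩

theorem eq_of_part_eq_none_iff {c c' : Composition N}
    (h : ∀ x, c.part x = none ↔ c'.part x = none) : c = c' := by
  apply (compositionEquiv N).injective
  refine CompositionAsSet.ext ?_
  change c.boundaries = c'.boundaries
  ext y
  induction y using Fin.lastCases with
  | last => exact iff_of_true c.toCompositionAsSet.getLast_mem c'.toCompositionAsSet.getLast_mem
  | cast x => rw [castSucc_mem_boundaries_iff, castSucc_mem_boundaries_iff, h]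

theorem exists_part_eq_none_iff [NeZero N] (S : Set (Fin N)) (h0 : 0 ∈ S) :
    ∃ c : Composition N, ∀ x, c.part x = none ↔ x ∈ S := by
  classical
  let b : CompositionAsSet N :=
    -- Boundaries live in `Fin (N + 1)`, so the right end must be added to `S`.
    { boundaries := Finset.univ.filter fun y => y = Fin.last N ∨ ∃ x ∈ S, x.castSucc = y
      zero_mem := by
        simp only [Finset.mem_filter, Finset.mem_univ, true_and]
        exact .inr ⟨0, h0, rfl⟩
      getLast_mem := by simp }
  refine ⟨b.toComposition, fun x => ?_⟩
  rw [← castSucc_mem_boundaries_iff, b.toComposition_boundaries]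
  simp [b]

theorem part_zero [NeZero N] : c.part 0 = none := by
  rw [← castSucc_mem_boundaries_iff]
  exact c.toCompositionAsSet.zero_mem

end Composition

/-! ### Decomposition along the component of the first point -/

namespace ArcDiagram

open ArcSystem Composition

variable {N : ℕ} [NeZero N]

/-- The composition whose blocks start at the points of the component of `0`. -/
noncomputable def rootComposition (D : ArcDiagram (Fin N)) : Composition N :=
  (exists_part_eq_none_iff {x | D.comp 0 x} (D.comp.refl 0)).choose

theorem part_rootComposition (D : ArcDiagram (Fin N)) (x : Fin N) :
    D.rootComposition.part x = none ↔ D.comp 0 x :=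
  (exists_part_eq_none_iff {x | D.comp 0 x} (D.comp.refl 0)).choose_spec x

/-- An arc between two different gaps would cover a point of the component of `0`, hence the whole
component, but nothing lies to the left of `0`. -/
theorem part_rootComposition_α (D : ArcDiagram (Fin N)) (x : Fin N) :
    D.rootComposition.part (D.α x) = D.rootComposition.part x := by
  set c := D.rootComposition with hc
  by_cases h0 : D.comp 0 x
  · rw [(part_rootComposition D x).2 h0,
      (part_rootComposition D _).2 (D.comp.trans h0 (comp_α x))]
  have key (x : Fin N) (h0 : ¬ D.comp 0 x) (hlt : x < D.α x) : c.part (D.α x) = c.part x := by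
    have h0' : ¬ D.comp 0 (D.α x) := fun h => h0 (D.comp.trans h (D.comp.symm (comp_α x)))
    have hx : c.part x ≠ none := (part_rootComposition D x).not.2 h0
    have hαx : c.part (D.α x) ≠ none := (part_rootComposition D _).not.2 h0'
    obtain ⟨i, hi⟩ := Option.ne_none_iff_exists'.1 hx
    obtain ⟨j, hj⟩ := Option.ne_none_iff_exists'.1 hαx
    by_cases hij : i = j
    · rw [hi, hj, hij]
    rw [part_eq_some] at hi hj
    have hle : i ≤ j := by
      rw [← hi.1, ← hj.1]
      exact c.index_mono hlt.le
    have hlt1 := c.lt_sizeUpTo_index_succ x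
    rw [hi.1, Fin.val_succ] at hlt1
    have hle1 : c.sizeUpTo (i + 1) ≤ c.sizeUpTo j := c.monotone_sizeUpTo (by omega)
    let f : Fin N := ⟨c.sizeUpTo j, by omega⟩
    have hf : c.part f = none := by
      have : f = c.embedding j ⟨0, c.one_le_blocksFun j⟩ := Fin.ext (by rw [coe_embedding]; rfl)
      rw [part_eq_none, this, index_embedding, coe_embedding]
      rfl
    have hcf := (part_rootComposition D f).1 hf
    have h3 := (comp_mem_interval_iff hcf (fun h => h0 (D.comp.symm h))).2
      ⟨Fin.lt_def.2 (hlt1.trans_le hle1), Fin.lt_def.2 hj.2⟩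
    exact absurd h3.1 (Fin.zero_le _).not_gt
  rcases lt_or_gt_of_ne (D.ne x) with hlt | hlt
  · have := key (D.α x) (fun h => h0 (D.comp.trans h (D.comp.symm (comp_α x))))
      (by rwa [D.invol x])
    rw [D.invol x] at this
    exact this.symm
  · exact key x h0 hlt

/-- The component of `0` in the glued diagram stays within the set of first points, and fills it
exactly when the diagram on that set is connected. -/
theorem rootComposition_glue_eq_iff {c : Composition N}
    {F : ∀ i, ArcDiagram {x // c.part x = i}} :
    (glue c.noncrossingFibres_part F).rootComposition = c ↔ ∀ x y, (F none).comp x y := by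
  constructor
  · intro h x y
    have h1 (x : {x // c.part x = none}) : (glue c.noncrossingFibres_part F).comp 0 x := by
      rw [← part_rootComposition, h]
      exact x.2
    rw [← comp_glue_iff (hp := c.noncrossingFibres_part) (F := F)]
    exact Setoid.trans' _ (Setoid.symm' _ (h1 x)) (h1 y)
  · intro h
    refine eq_of_part_eq_none_iff fun x => ?_
    rw [part_rootComposition]
    constructor
    · intro hx
      rw [← comp_apply_eq c.noncrossingFibres_part apply_glue_α hx, part_zero]
    · intro hx
      exact comp_glue_iff.2 (h ⟨0, c.part_zero⟩ ⟨x, hx⟩)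

open Polynomial in
/-- The decomposition of arc diagrams along the component of the first point. -/
theorem compPoly_fin (N : ℕ) [NeZero N] : compPoly (Fin N) = ∑ c : Composition N,
    (connCount (Fin c.length) : ℤ[X]) * X * ∏ i, compPoly (Fin (c.blocksFun i - 1)) := by
  classical
  rw [compPoly, ← Finset.sum_fiberwise _ rootComposition]
  refine Finset.sum_congr rfl fun c _ => ?_
  -- Connectedness is imposed on the part of first points only, so that the sum over all families
  -- factors as a product over the parts.
  let g : ∀ o, ArcDiagram {x // c.part x = o} → ℤ[X] := fun o E =>
    if o = none → ∀ x y, E.comp x y then X ^ Nat.card (Quotient E.comp) else 0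
  have hg : ∏ o, ∑ E, g o E = (connCount (Fin c.length) : ℤ[X]) * X *
      ∏ i, compPoly (Fin (c.blocksFun i - 1)) := by
    rw [Fintype.prod_option]
    congr 1
    · have : Nonempty {x // c.part x = none} := ⟨⟨0, c.part_zero⟩⟩
      have h := sum_connected {x // c.part x = none}
      rw [connCount_eq_fin, card_part_none] at h
      rw [← h]
      exact Finset.sum_congr rfl fun E _ => by simp [g]
    · refine Finset.prod_congr rfl fun i _ => ?_
      rw [← c.card_part_some i, ← compPoly_eq_fin, compPoly]
      exact Finset.sum_congr rfl fun E _ => by simp [g]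
  rw [← hg, Finset.prod_univ_sum, Fintype.piFinset_univ]
  have hprod (F : ∀ o, ArcDiagram {x // c.part x = o}) : ∏ o, g o (F o) =
      if ∀ x y, (F none).comp x y then
        X ^ Nat.card (Quotient (glue c.noncrossingFibres_part F).comp) else 0 := by
    rw [card_quotient_glue, Fintype.prod_option, Fintype.sum_option, pow_add]
    by_cases h : ∀ x y, (F none).comp x y
    · rw [if_pos h, ← Finset.prod_pow_eq_pow_sum]
      congr 1
      simp [g, h]
    · rw [if_neg h]
      have : g none (F none) = 0 := if_neg (by simpa using h)
      rw [this, zero_mul]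
  simp_rw [hprod]
  rw [← Finset.sum_filter]
  symm
  refine Finset.sum_nbij (glue c.noncrossingFibres_part) ?_ ?_ ?_ fun _ _ => rfl
  · intro F hF
    simp only [Finset.mem_filter, Finset.mem_univ, true_and] at hF ⊢
    exact rootComposition_glue_eq_iff.2 hF
  · exact (glue_injective _).injOn
  · intro D hD
    simp only [Finset.coe_filter, Finset.mem_univ, true_and, Set.mem_ofPred_eq] at hD
    obtain ⟨F, rfl⟩ := exists_glue_eq c.noncrossingFibres_part D (by
      rw [← hD]; exact D.part_rootComposition_α)
    refine ⟨F, ?_, rfl⟩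
    simpa using rootComposition_glue_eq_iff.1 hD

end ArcDiagram

/-! ### Sums over compositions as power series coefficients -/

/-- A block of size `b` is a first point and a gap of `b - 1` points. Its weight `w (b - 1)` is the
coefficient of degree `b` in `X * mk w`. -/
theorem Composition.sum_length_eq {R : Type*} [CommRing R] (w : ℕ → R) (N K : ℕ) :
    ∑ c : Composition N with c.length = K, ∏ i, w (c.blocksFun i - 1) =
      PowerSeries.coeff N ((PowerSeries.X * PowerSeries.mk w) ^ K) := by
  classical
  set Y : PowerSeries R := PowerSeries.X * PowerSeries.mk w with hY
  have hY0 : PowerSeries.coeff 0 Y = 0 := by simp [hY]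
  have hYs (j : ℕ) (hj : j ≠ 0) : PowerSeries.coeff j Y = w (j - 1) := by
    obtain ⟨j, rfl⟩ := Nat.exists_eq_succ_of_ne_zero hj
    rw [hY, PowerSeries.coeff_succ_X_mul, PowerSeries.coeff_mk]
    rfl
  have h1 : Y ^ K = ∏ _i : Fin K, Y := by simp
  -- The zero constant term of `Y` discards tuples with a zero entry; the remaining ones are the
  -- compositions with `K` blocks.
  rw [h1, PowerSeries.coeff_prod, ← Finset.sum_filter_of_ne (p := fun l : Fin K →₀ ℕ => ∀ i, l i ≠ 0)]
  swap
  · intro l _ hl i hi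
    exact hl (Finset.prod_eq_zero (Finset.mem_univ i) (by rw [hi, hY0]))
  refine Finset.sum_bij (fun c hc => Finsupp.equivFunOnFinite.symm
    fun i => c.blocksFun (Fin.cast (Finset.mem_filter.1 hc).2.symm i)) ?_ ?_ ?_ ?_
  · intro c hc
    obtain rfl : c.length = K := by simpa using hc
    simp only [Finset.mem_filter, Finset.mem_finsuppAntidiag]
    refine ⟨⟨?_, Finset.subset_univ _⟩, fun i => ?_⟩
    · simp [c.sum_blocksFun]
    · have := c.one_le_blocksFun i
      simp
      omega
  · intro c hc c' hc' h
    have hl : c.length = K := by simpa using hc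
    have hl' : c'.length = K := by simpa using hc'
    have h2 := Finsupp.equivFunOnFinite.symm.injective h
    refine Composition.ext ?_
    rw [← c.ofFn_blocksFun, ← c'.ofFn_blocksFun, List.ofFn_congr hl, List.ofFn_congr hl']
    exact congrArg List.ofFn h2
  · intro l hl
    simp only [Finset.mem_filter, Finset.mem_finsuppAntidiag] at hl
    refine ⟨⟨List.ofFn l, ?_, ?_⟩, ?_, ?_⟩
    · intro i hi
      obtain ⟨j, rfl⟩ := (List.mem_ofFn' _ _).1 hi
      exact Nat.pos_of_ne_zero (hl.2 j)
    · rw [List.sum_ofFn]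
      exact hl.1.1
    · simp [Composition.length]
    · ext i
      simp [Composition.blocksFun]
  · intro c hc
    obtain rfl : c.length = K := by simpa using hc
    refine Finset.prod_congr rfl fun i _ => ?_
    have := c.one_le_blocksFun i
    rw [hYs]
    · rfl
    · exact Nat.one_le_iff_ne_zero.1 this

theorem Composition.sum_eq {R : Type*} [CommRing R] (f w : ℕ → R) (N : ℕ) :
    ∑ c : Composition N, f c.length * ∏ i, w (c.blocksFun i - 1) =
      ∑ K ∈ Finset.range (N + 1), f K *
        PowerSeries.coeff N ((PowerSeries.X * PowerSeries.mk w) ^ K) := by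
  rw [← Finset.sum_fiberwise_of_maps_to (t := Finset.range (N + 1)) (g := Composition.length)
    fun c _ => by simp]
  refine Finset.sum_congr rfl fun K _ => ?_
  rw [← Composition.sum_length_eq, Finset.mul_sum]
  refine Finset.sum_congr rfl fun c hc => ?_
  obtain rfl : c.length = K := by simpa using hc
  rfl

theorem PowerSeries.coeff_pow_eq_zero_of_lt {R : Type*} [CommRing R] {a : PowerSeries R}
    (ha : constantCoeff a = 0) {n d : ℕ} (h : n < d) : coeff n (a ^ d) = 0 := by
  have h1 : X ^ d ∣ a ^ d := pow_dvd_pow_of_dvd (X_dvd_iff.2 ha) d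
  exact X_pow_dvd_iff.1 h1 n h

theorem PowerSeries.coeff_subst_eq_sum_range {R : Type*} [CommRing R] [Algebra ℤ R]
    {a : PowerSeries R} (ha : constantCoeff a = 0) (f : PowerSeries ℤ) (n : ℕ) :
    coeff n (subst a f : PowerSeries R) =
      ∑ d ∈ Finset.range (n + 1), ((coeff d f : ℤ) : R) * coeff n (a ^ d) := by
  rw [coeff_subst' (HasSubst.of_constantCoeff_zero' ha)]
  simp_rw [Algebra.smul_def, eq_intCast]
  refine finsum_eq_sum_of_support_subset _ fun d hd => ?_
  by_contra hnd
  refine hd ?_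
  simp only
  rw [coeff_pow_eq_zero_of_lt ha (by simpa using hnd), mul_zero]

theorem Finset.sum_range_two_mul_add_one {R : Type*} [AddCommMonoid R] (f : ℕ → R)
    (hf : ∀ n, ¬ 2 ∣ n → f n = 0) (n : ℕ) :
    ∑ k ∈ range (2 * n + 1), f k = ∑ k ∈ range (n + 1), f (2 * k) := by
  induction n with
  | zero => simp
  | succ n ih =>
    rw [show 2 * (n + 1) + 1 = (2 * n + 1) + 1 + 1 by ring, sum_range_succ, sum_range_succ, ih,
      sum_range_succ _ (n + 1), hf (2 * n + 1) (by omega), add_zero]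
    rfl

/-! ### The functional equations -/

namespace ArcDiagram

open Polynomial

theorem isEmpty_of_not_two_dvd {N : ℕ} (h : ¬ 2 ∣ N) : IsEmpty (ArcDiagram (Fin N)) :=
  ⟨fun D => h ⟨_, (Nat.card_fin N).symm.trans D.card_eq_two_mul⟩⟩

theorem compPoly_of_not_two_dvd {N : ℕ} (h : ¬ 2 ∣ N) : compPoly (Fin N) = 0 := by
  have := isEmpty_of_not_two_dvd h
  exact Finset.sum_of_isEmpty _

theorem connCount_of_not_two_dvd {N : ℕ} (h : ¬ 2 ∣ N) : connCount (Fin N) = 0 := by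
  have := isEmpty_of_not_two_dvd h
  exact Nat.card_of_isEmpty

theorem coeff_seriesMu (n : ℕ) :
    PowerSeries.coeff n TreeRootedMap.seriesMu = compPoly (Fin (2 * n)) := by
  rw [TreeRootedMap.seriesMu, PowerSeries.coeff_mk, compPoly, ← finsum_eq_sum_of_fintype]
  exact (finsum_eq_of_bijective (equivTreeRootedMap n) (equivTreeRootedMap n).bijective
    fun D => by rw [← numBlocks_eq]; rfl).symm

theorem coeff_seriesB (n : ℕ) :
    PowerSeries.coeff n TreeRootedMap.seriesB = (connCount (Fin (2 * n)) : ℤ) := by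
  rw [TreeRootedMap.seriesB, PowerSeries.coeff_mk, connCount]
  congr 1
  symm
  refine (Nat.card_congr ((equivTreeRootedMap n).subtypeEquiv
    (q := fun m => m.1.IsTwoConnected) fun D => ?_)).trans ?_
  · exact (isTwoConnected_iff D).symm
  · refine (Nat.card_congr (Equiv.subtypeSubtypeEquivSubtypeInter _ _)).trans
      (Nat.card_congr (Equiv.subtypeEquivRight fun m => and_comm))

theorem coeff_seriesM (n : ℕ) : PowerSeries.coeff n TreeRootedMap.seriesM =
    (compPoly (Fin (2 * n))).eval 1 := by
  rw [TreeRootedMap.seriesM, PowerSeries.coeff_mk, ← Nat.card_congr (equivTreeRootedMap n),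
    compPoly, eval_finsetSum]
  simp

theorem compPoly_zero : compPoly (Fin 0) = 1 := by
  have : Nat.card {m : TreeRootedMap // m.size = 0} = 1 := by
    rw [Nat.card_eq_one_iff_unique]
    refine ⟨⟨fun a b => ?_⟩, ⟨.vertexMap, rfl⟩⟩
    refine (equivTreeRootedMap 0).symm.injective (ArcDiagram.ext ?_ ?_)
    · exact funext fun x => x.elim0
    · exact Set.ext fun x => x.elim0
  rw [← Nat.card_congr (equivTreeRootedMap 0), Nat.card_eq_one_iff_unique] at this
  obtain ⟨h1, ⟨D⟩⟩ := this
  have : Subsingleton (ArcDiagram (Fin 0)) := h1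
  rw [compPoly, Fintype.sum_subsingleton _ D]
  have : IsEmpty (Quotient D.comp) := ⟨fun q => q.inductionOn fun x => x.elim0⟩
  rw [Nat.card_of_isEmpty, pow_zero]

theorem connCount_zero : connCount (Fin 0) = 1 := by
  have h := compPoly_zero
  rw [compPoly] at h
  have h' := congrArg (eval 1) h
  rw [eval_finsetSum] at h'
  rw [connCount, Nat.card_congr (Equiv.subtypeUnivEquiv fun D x => x.elim0)]
  simpa using h'

/-- The substitution `z = t ^ 2` passes from counting edges to counting points. -/
theorem expand_seriesMu : PowerSeries.expand 2 two_ne_zero TreeRootedMap.seriesMu =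
    PowerSeries.mk fun N => compPoly (Fin N) := by
  ext1 N
  rw [PowerSeries.coeff_mk]
  by_cases h : 2 ∣ N
  · obtain ⟨n, rfl⟩ := h
    rw [PowerSeries.coeff_expand_mul, coeff_seriesMu]
  · rw [PowerSeries.coeff_expand_of_not_dvd _ _ _ h, compPoly_of_not_two_dvd h]

theorem constantCoeff_X_mul_sq {R : Type*} [CommRing R] (f : PowerSeries R) :
    PowerSeries.constantCoeff (PowerSeries.X * f ^ 2) = 0 := by simp

theorem coeff_seriesMu_eq_sum {n : ℕ} (hn : n ≠ 0) :
    PowerSeries.coeff n TreeRootedMap.seriesMu = X * ∑ d ∈ Finset.range (n + 1),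
      ((PowerSeries.coeff d TreeRootedMap.seriesB : ℤ) : ℤ[X]) *
        PowerSeries.coeff n ((PowerSeries.X * TreeRootedMap.seriesMu ^ 2) ^ d) := by
  have : NeZero (2 * n) := ⟨by omega⟩
  rw [coeff_seriesMu, compPoly_fin,
    Composition.sum_eq (fun K => (connCount (Fin K) : ℤ[X]) * X) (fun K => compPoly (Fin K)),
    Finset.sum_range_two_mul_add_one, Finset.mul_sum]
  · refine Finset.sum_congr rfl fun d _ => ?_
    have h : (PowerSeries.X * PowerSeries.mk fun K => compPoly (Fin K)) ^ (2 * d) =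
        PowerSeries.expand 2 two_ne_zero
          ((PowerSeries.X * TreeRootedMap.seriesMu ^ 2) ^ d) := by
      rw [map_pow, map_mul, map_pow, expand_seriesMu, PowerSeries.expand_X, pow_mul, mul_pow]
    rw [h, PowerSeries.coeff_expand_mul, coeff_seriesB, Int.cast_natCast]
    ring
  · intro K hK
    rw [connCount_of_not_two_dvd hK, Nat.cast_zero, zero_mul, zero_mul]

theorem seriesMu_eq : TreeRootedMap.seriesMu =
    PowerSeries.C (X : ℤ[X]) * (PowerSeries.subst
      (PowerSeries.X * TreeRootedMap.seriesMu ^ 2 : PowerSeries ℤ[X])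
        TreeRootedMap.seriesB : PowerSeries ℤ[X]) + 1 - PowerSeries.C (X : ℤ[X]) := by
  ext1 n
  rw [map_sub, map_add, PowerSeries.coeff_C_mul,
    PowerSeries.coeff_subst_eq_sum_range (constantCoeff_X_mul_sq _)]
  by_cases hn : n = 0
  -- In degree `0` the empty diagram counts as connected but has no component: `1 = u * 1 + 1 - u`.
  · subst hn
    rw [coeff_seriesMu]
    simp [coeff_seriesB, compPoly_zero, connCount_zero]
  · rw [coeff_seriesMu_eq_sum hn, PowerSeries.coeff_one, if_neg hn, PowerSeries.coeff_C, if_neg hn,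
      add_zero, sub_zero]

theorem map_seriesMu :
    PowerSeries.map (evalRingHom 1) TreeRootedMap.seriesMu = TreeRootedMap.seriesM := by
  ext1 n
  rw [PowerSeries.coeff_map, coeff_seriesM, coeff_seriesMu, coe_evalRingHom]

theorem seriesM_eq : TreeRootedMap.seriesM =
    PowerSeries.subst (PowerSeries.X * TreeRootedMap.seriesM ^ 2 : PowerSeries ℤ)
      TreeRootedMap.seriesB := by
  ext1 n
  rw [PowerSeries.coeff_subst_eq_sum_range (constantCoeff_X_mul_sq _)]
  by_cases hn : n = 0
  · subst hn
    simp [coeff_seriesM, coeff_seriesB, compPoly_zero, connCount_zero]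
  · have h : PowerSeries.X * TreeRootedMap.seriesM ^ 2 = PowerSeries.map (evalRingHom 1)
        (PowerSeries.X * TreeRootedMap.seriesMu ^ 2) := by
      rw [map_mul, map_pow, map_seriesMu, PowerSeries.map_X]
    nth_rw 1 [← map_seriesMu]
    rw [PowerSeries.coeff_map, coeff_seriesMu_eq_sum hn, map_mul, map_sum, coe_evalRingHom, eval_X,
      one_mul]
    refine Finset.sum_congr rfl fun d _ => ?_
    rw [h, ← map_pow, PowerSeries.coeff_map, coe_evalRingHom, eval_mul, eval_intCast]

end ArcDiagram

theorem mainTheorem12 :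
    (∀ n : ℕ, Finite {m : TreeRootedMap // m.size = n}) ∧
    TreeRootedMap.seriesM =
      PowerSeries.subst (PowerSeries.X * TreeRootedMap.seriesM ^ 2 : PowerSeries ℤ)
        TreeRootedMap.seriesB ∧
    TreeRootedMap.seriesMu =
      PowerSeries.C (Polynomial.X : Polynomial ℤ) *
        (PowerSeries.subst
          (PowerSeries.X * TreeRootedMap.seriesMu ^ 2 : PowerSeries (Polynomial ℤ))
          TreeRootedMap.seriesB : PowerSeries (Polynomial ℤ)) +
        1 - PowerSeries.C (Polynomial.X : Polynomial ℤ) :=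
  ⟨fun n => Finite.of_equiv _ (ArcDiagram.equivTreeRootedMap n), ArcDiagram.seriesM_eq,
    ArcDiagram.seriesMu_eq⟩
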